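/- Let $\mathbb N=\{1,2,\dots\}$ and, for an infinite $M\subset\mathbb N$, let $[M]$ be the set of infinite subsets of $M$. For finite sets, $n\le F$ means $n\le\min F$, and $F<G$ means $\max F<\min G$. For each countable limit ordinal $\xi$ fix ordinals $(\xi_n)_{n\in\mathbb N}$ such that the successor ordinals $\xi_n+1$ strictly increase to $\xi$; the choice is arbitrary. *Schreier families.* $S_0=\{\emptyset\}\cup\{\{n\}:n\in\mathbb N\}$; $S_{\zeta+1}$ consists of $\emptyset$ and all $F_1\cup\dots\cup F_n$ with $n\ge 1$, $n\le F_1<\dots<F_n$ and nonempty $F_i\in S_\zeta$; for a limit ordinal $\xi$, $S_\xi$ consists of all finite $F$ such that $n\le F$ and $F\in S_{\xi_n+1}$ for some $n$ (with $\emptyset\in S_\xi$). *Repeated averages.* For $\xi<\omega_1$ and infinite $M=\{m_1<m_2<\cdots\}$ define finitely supported probability measures $\xi^M_1<\xi^M_2<\cdots$ (successive supports) on $\mathbb N$ by transfinite induction: $0^M_n=e_{m_n}$. For $\xi\geq 1$ put $\xi^M_1=\frac1{m_1}\sum_{i=1}^{m_1}\zeta^M_i$ if $\xi=\zeta+1$,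 and $\xi^M_1=[\xi_{m_1}+1]^M_1$ if $\xi$ is a limit ordinal; in both cases $\xi^M_{n+1}=\xi^{M_n}_1$, where $M_n=\{m\in M:m>\max\operatorname{supp}\xi^M_n\}$. A sequence $(x_n)$ in a real Banach space is $(L,\xi)$-convergent if $\lim_n\bigl\|\sum_k\xi^L_n(k)\,x_k\bigr\|=0$. A sequence $(y_n)$ is an $\ell_1^\xi$ spreading model if $0<\inf_n\|y_n\|\le\sup_n\|y_n\|<\infty$ and there is $C>0$ with $\bigl\|\sum_{i\in F}a_iy_i\bigr\|\ge C\sum_{i\in F}|a_i|$ for all $F\in S_\xi$ and all real scalars $(a_i)_{i\in F}$. **Theorem.** Let $(x_n)$ be a weakly null sequence in a real Banach space and let $1\le\xi<\omega_1$. Then exactly one of the following holds. 1. For every infinite $M\subset\mathbb N$ there exists $N\in[M]$ such that $(x_n)$ is $(L,\xi)$-convergent for every $L\in[N]$. 2. There exists an infinite $M=\{m_1<m_2<\cdots\}\subset\mathbb N$ such that $(x_{m_i})_{i}$ is an $\ell_1^\xi$ spreading model. -/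

import Mathlib

open Filter Topology Ordinal

noncomputable section

namespace RepeatedAverages

/-- A choice, for every countable limit ordinal `ξ`, of ordinals `ξ₁, ξ₂, …` such that the
successor ordinals `ξₙ + 1` strictly increase to `ξ`.  The positive integers `ℕ+` play the role of
the index set `{1, 2, 3, …}` everywhere. -/
structure AssociatedSequences where
  /-- `seq ξ n` is the ordinal `ξₙ`. -/
  seq : Ordinal.{0} → ℕ+ → Ordinal.{0}
  strictMono : ∀ ξ, ξ < ω₁ → Order.IsSuccLimit ξ → StrictMono fun n => seq ξ n + 1
  isLUB : ∀ ξ, ξ < ω₁ → Order.IsSuccLimit ξ → IsLUB (Set.range fun n => seq ξ n + 1) ξ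

/-- The successor step for the Schreier families: all `F = F₁ ∪ … ∪ Fₙ` with `n ≥ 1`,
nonempty `Fᵢ ∈ S`, and `n ≤ F₁ < ⋯ < Fₙ`; together with the empty set. -/
def schreierSucc (S : Set (Finset ℕ+)) : Set (Finset ℕ+) :=
  {F | ∃ (n : ℕ+) (G : Fin n → Finset ℕ+),
      (∀ i, G i ∈ S ∧ (G i).Nonempty) ∧
      (∀ i j, i < j → ∀ p ∈ G i, ∀ q ∈ G j, p < q) ∧
      (∀ i, ∀ p ∈ G i, n ≤ p) ∧
      F = Finset.univ.biUnion G} ∪ {∅}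

/-- The generalized Schreier families `S_ξ`.  (At a countable limit ordinal the inequality
`ξₙ + 1 < ξ` is automatic, so that `S_ξ` consists of the finite `F` such that `n ≤ min F` and
`F ∈ S_{ξₙ + 1}` for some `n`; the values at uncountable ordinals play no role.) -/
def schreier (A : AssociatedSequences) (ξ : Ordinal.{0}) : Set (Finset ℕ+) :=
  Ordinal.limitRecOn ξ
    {F | F = ∅ ∨ ∃ n, F = {n}}
    (fun _ S => schreierSucc S)
    (fun ξ _ S =>
      {F | ∃ n : ℕ+, (∀ p ∈ F, n ≤ p) ∧ ∃ h : A.seq ξ n + 1 < ξ, F ∈ S (A.seq ξ n + 1) h})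

/-- The least element of a nonempty set of positive integers. -/
def minElt (M : Set ℕ+) : ℕ+ :=
  open Classical in if h : M.Nonempty then WellFounded.min wellFounded_lt M h else 1

/-- `{m ∈ M : m > max supp μ}`. -/
def tail (M : Set ℕ+) (μ : ℕ+ →₀ ℝ) : Set ℕ+ := {m ∈ M | ∀ k ∈ μ.support, k < m}

/-- Given the map `first : M ↦ ξ₁ᴹ`, the whole sequence `ξ₁ᴹ, ξ₂ᴹ, …` (the index `n : ℕ` here
starts at `0`): `ξ₁ᴹ = first M`, and `ξₙ₊₁ᴹ = first Mₙ` where `Mₙ = {m ∈ M : m > max supp ξₙᴹ}`. -/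
def iterateFirst (first : Set ℕ+ → (ℕ+ →₀ ℝ)) (M : Set ℕ+) : ℕ → (ℕ+ →₀ ℝ)
  | 0 => first M
  | n + 1 => first (tail M (iterateFirst first M n))

/-- The first repeated average `ξ₁ᴹ` of order `ξ`:
* `0₁ᴹ = e_{min M}`;
* `[ζ + 1]₁ᴹ = (1 / m₁) (ζ₁ᴹ + ⋯ + ζ_{m₁}ᴹ)` with `m₁ = min M`;
* `ξ₁ᴹ = [ξ_{m₁} + 1]₁ᴹ` with `m₁ = min M`, if `ξ` is a countable limit ordinal (the inequality
  `ξ_{m₁} + 1 < ξ` is then automatic; the values at uncountable ordinals play no role). -/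
def firstAverage (A : AssociatedSequences) (ξ : Ordinal.{0}) : Set ℕ+ → (ℕ+ →₀ ℝ) :=
  Ordinal.limitRecOn ξ
    (fun M => Finsupp.single (minElt M) 1)
    (fun _ first M =>
      (((minElt M : ℕ) : ℝ)⁻¹) • ∑ i ∈ Finset.range (minElt M : ℕ), iterateFirst first M i)
    (fun ξ _ first M =>
      open Classical in
      if h : A.seq ξ (minElt M) + 1 < ξ then first (A.seq ξ (minElt M) + 1) h M else 0)

/-- The repeated averages: `average A ξ M n` is `ξₙ₊₁ᴹ` (the index `n : ℕ` starts at `0`).  It is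
an element of the span of the unit vector basis of `ℓ₁`.  For `ξ = 0` this is the sequence
`e_{m₁}, e_{m₂}, …` where `M = {m₁ < m₂ < ⋯}`. -/
def average (A : AssociatedSequences) (ξ : Ordinal.{0}) (M : Set ℕ+) (n : ℕ) : ℕ+ →₀ ℝ :=
  iterateFirst (firstAverage A ξ) M n

variable {X : Type*} [NormedAddCommGroup X] [NormedSpace ℝ X]

/-- `μ · x = ∑ₙ μ(n) xₙ`. -/
def act (μ : ℕ+ →₀ ℝ) (x : ℕ+ → X) : X := μ.sum fun n a => a • x n

/-- The sequence `x` converges weakly to zero. -/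
def WeaklyNull (x : ℕ+ → X) : Prop :=
  ∀ f : X →L[ℝ] ℝ, Tendsto (fun n => f (x n)) atTop (𝓝 0)

/-- The sequence `x` is `(ξ, M)` convergent: `‖ξₙᴹ · x‖ → 0`. -/
def IsConvergentAlong (A : AssociatedSequences) (ξ : Ordinal.{0}) (M : Set ℕ+) (x : ℕ+ → X) :
    Prop :=
  Tendsto (fun n => ‖act (average A ξ M n) x‖) atTop (𝓝 0)

/-- `0 < inf ‖xₙ‖ ≤ sup ‖xₙ‖ < ∞`. -/
def SemiNormalized (x : ℕ+ → X) : Prop :=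
  ∃ c C : ℝ, 0 < c ∧ ∀ n, c ≤ ‖x n‖ ∧ ‖x n‖ ≤ C

/-- The sequence `x` is an `ℓ₁^ξ` spreading model. -/
def IsL1SpreadingModel (A : AssociatedSequences) (ξ : Ordinal.{0}) (x : ℕ+ → X) : Prop :=
  SemiNormalized x ∧
    ∃ C : ℝ, 0 < C ∧ ∀ F ∈ schreier A ξ, ∀ a : ℕ+ → ℝ,
      C * ∑ i ∈ F, |a i| ≤ ‖∑ i ∈ F, a i • x i‖

end RepeatedAverages

end

/-!
The two alternatives are separated by a Ramsey argument.  The first repeated average `ξ₁ᴸ` of an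
infinite set `L` is a probability measure carried by an initial segment of `L` and depending on that
initial segment only (`IsInitialAverage`); every later average is the first average of a tail of
`L`.  So `‖ξ₁ᴸ · x‖ > ε` is an open condition on `L`, and the infinite Ramsey theorem for open sets
(`exists_homogeneous`), followed by a diagonalization over `ε`, shows that if the first alternative
fails, then `‖ξ₁ᴸ · x‖ > ε` for all infinite subsets `L` of some infinite set
(`exists_norm_act_gt`).

Norming functionals then show that the family `𝓕` of those finite sets on which some functional of
the dual unit ball is at least `ε / 2` charges every `ξ₁ᴸ` with a mass bounded below.  The
combinatorial core `largeCaptures` says that such a family contains a transport of the Schreier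
family `S_ξ`.  It is proved by induction on `ξ`.  At a successor `ζ + 1`, many of the averages of
order `ζ` making up `[ζ + 1]₁ᴸ` must be charged by one and the same member of `𝓕`; as any
subsequence of averages is again the sequence of averages of a subset, `𝓕` may be assumed to charge
the first `k` averages simultaneously, and the `k` blocks are captured one after the other
(`LargeCaptures.captured_blocks`).  At a limit `ξ`, largeness for `ξ` gives largeness for
arbitrarily large `ξₘ`, and `S_η` is contained in `S_ζ` up to finitely many integers when `η ≤ ζ`.

Being in `𝓕` gives lower `ℓ₁`-estimates for nonnegative coefficients only.  For arbitrary signs, a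
second use of the Ramsey theorem together with weak-star compactness of the dual ball yields a
subsequence on which a functional that is large on `F ⊆ E` can be chosen small on `E \ F`
(`WeaklyNull.exists_unconditional`).

The alternatives exclude each other because, along a sufficiently sparse subset of a spreading
model, the support of every average of order `ξ ≥ 1`, apart from its first point, whose mass tends to
zero, sits at positions which form a member of `S_ξ` (`not_convergent_of_spreadingModel`).
-/

namespace RepeatedAverages

/-! ### Diagonalization and the infinite Ramsey theorem for open sets -/

/-- The part of `M` lying strictly above the finite set `s`. -/
def after (M : Set ℕ+) (s : Finset ℕ+) : Set ℕ+ := {m ∈ M | ∀ k ∈ s, k < m}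

lemma after_subset (M : Set ℕ+) (s : Finset ℕ+) : after M s ⊆ M := fun _ h => h.1

lemma after_mono {M M' : Set ℕ+} (h : M ⊆ M') (s : Finset ℕ+) : after M s ⊆ after M' s :=
  fun _ hm => ⟨h hm.1, hm.2⟩

lemma after_empty (M : Set ℕ+) : after M ∅ = M := by
  ext m; simp [after]

lemma after_infinite {M : Set ℕ+} (hM : M.Infinite) (s : Finset ℕ+) : (after M s).Infinite := by
  refine Set.infinite_of_forall_exists_gt fun a => ?_
  obtain ⟨b, hb, hab⟩ := hM.exists_gt ((insert a s).sup id)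
  refine ⟨b, ⟨hb, fun k hk => ?_⟩, ?_⟩
  · exact (Finset.le_sup (f := id) (Finset.mem_insert_of_mem hk)).trans_lt hab
  · exact (Finset.le_sup (f := id) (Finset.mem_insert_self a s)).trans_lt hab

lemma minElt_mem {M : Set ℕ+} (hM : M.Nonempty) : minElt M ∈ M := by
  unfold minElt
  rw [dif_pos hM]
  exact WellFounded.min_mem _ _ _

lemma minElt_le {M : Set ℕ+} {m : ℕ+} (hm : m ∈ M) : minElt M ≤ m := by
  unfold minElt
  rw [dif_pos ⟨m, hm⟩]
  exact not_lt.1 (WellFounded.not_lt_min _ (s := M) hm)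

lemma minElt_eq {M : Set ℕ+} {m : ℕ+} (hm : m ∈ M) (h : ∀ k ∈ M, m ≤ k) : minElt M = m :=
  le_antisymm (minElt_le hm) (h _ (minElt_mem ⟨m, hm⟩))

/-- A property of sets of integers inherited by subsets. -/
def Hereditary (Q : Set ℕ+ → Prop) : Prop := ∀ P P', P' ⊆ P → Q P → Q P'

/-- Every infinite subset of `M` has an infinite subset with the property `Q`. -/
def DenseBelow (M : Set ℕ+) (Q : Set ℕ+ → Prop) : Prop :=
  ∀ P ⊆ M, P.Infinite → ∃ P' ⊆ P, P'.Infinite ∧ Q P'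

lemma DenseBelow.forall_finset {ι : Type*} {M : Set ℕ+} {Q : ι → Set ℕ+ → Prop}
    (her : ∀ i, Hereditary (Q i)) (dense : ∀ i, DenseBelow M (Q i)) (T : Finset ι) :
    DenseBelow M fun P => ∀ i ∈ T, Q i P := by
  classical
  induction T using Finset.induction_on with
  | empty => exact fun P _ hi => ⟨P, subset_rfl, hi, by simp⟩
  | insert i T _ ih =>
    intro P hP hi
    obtain ⟨P₁, h₁, hi₁, hQ₁⟩ := ih P hP hi
    obtain ⟨P₂, h₂, hi₂, hQ₂⟩ := dense i P₁ (h₁.trans hP) hi₁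
    refine ⟨P₂, h₂.trans h₁, hi₂, fun j hj => ?_⟩
    rcases Finset.mem_insert.1 hj with rfl | hj
    · exact hQ₂
    · exact her _ _ _ h₂ (hQ₁ j hj)

/-- Diagonalization: countably many hereditary dense properties `Q s` hold simultaneously on one
infinite set `N`, the property with index `s ⊆ N` being required only beyond `s`. -/
theorem exists_diagonal {M : Set ℕ+} (hM : M.Infinite) {Q : Finset ℕ+ → Set ℕ+ → Prop}
    (her : ∀ s, Hereditary (Q s)) (dense : ∀ s, DenseBelow M (Q s)) :
    ∃ N ⊆ M, N.Infinite ∧ ∀ s : Finset ℕ+, (s : Set ℕ+) ⊆ N → Q s (after N s) := by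
  classical
  have step : ∀ (n : ℕ+) (P : {P : Set ℕ+ // P ⊆ M ∧ P.Infinite}),
      ∃ P' : {P : Set ℕ+ // P ⊆ M ∧ P.Infinite}, P'.1 ⊆ after P.1 {n} ∧
        ∀ s ∈ (Finset.Iic n).powerset, Q s P'.1 := by
    rintro n ⟨P, hP, hi⟩
    obtain ⟨P', h', hi', hQ'⟩ := DenseBelow.forall_finset her dense (Finset.Iic n).powerset
      (after P {n}) ((after_subset _ _).trans hP) (after_infinite hi _)
    exact ⟨⟨P', h'.trans ((after_subset _ _).trans hP), hi'⟩, h', hQ'⟩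
  choose next hnext hQ using step
  obtain ⟨P₀, h₀, hi₀, hQ₀⟩ := dense ∅ M subset_rfl hM
  let P : ℕ → {P : Set ℕ+ // P ⊆ M ∧ P.Infinite} := fun j =>
    Nat.rec ⟨P₀, h₀, hi₀⟩ (fun _ R => next (minElt R.1) R) j
  let n : ℕ → ℕ+ := fun j => minElt (P j).1
  have hP : ∀ j, (P (j + 1)).1 ⊆ after (P j).1 {n j} := fun j => hnext _ _
  have hn : ∀ j, n j ∈ (P j).1 := fun j => minElt_mem (P j).2.2.nonempty
  have hanti : Antitone fun j => (P j).1 :=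
    antitone_nat_of_succ_le fun j => (hP j).trans (after_subset _ _)
  have hmono : StrictMono n :=
    strictMono_nat_of_lt_succ fun j => (hP j (hn (j + 1))).2 _ (Finset.mem_singleton_self _)
  refine ⟨Set.range n, ?_, Set.infinite_range_of_injective hmono.injective, fun s hs => ?_⟩
  · rintro _ ⟨j, rfl⟩
    exact (P j).2.1 (hn j)
  · rcases s.eq_empty_or_nonempty with rfl | hne
    · rw [after_empty]
      refine her _ _ _ ?_ hQ₀
      rintro _ ⟨j, rfl⟩
      exact hanti (Nat.zero_le j) (hn j)
    · obtain ⟨j, hj⟩ := hs (s.max'_mem hne)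
      refine her _ _ _ ?_ (hQ (n j) (P j) s ?_)
      · rintro _ ⟨⟨i, rfl⟩, hi⟩
        have : j < i := hmono.lt_iff_lt.1 (hj ▸ hi _ (s.max'_mem hne))
        exact hanti (Nat.succ_le_of_lt this) (hn i)
      · rw [Finset.mem_powerset]
        intro k hk
        rw [Finset.mem_Iic, hj]
        exact s.le_max' _ hk

/-- Two sets of positive integers have the same elements up to `n`. -/
def AgreeUpTo (n : ℕ+) (L L' : Set ℕ+) : Prop := ∀ k ≤ n, k ∈ L ↔ k ∈ L'

/-- The infinite Ramsey theorem for sets which are open in the topology of pointwise convergence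
(Nash-Williams, Galvin). -/
theorem exists_homogeneous (O : Set ℕ+ → Prop)
    (hO : ∀ L : Set ℕ+, L.Infinite → O L →
      ∃ n, ∀ L' : Set ℕ+, L'.Infinite → AgreeUpTo n L L' → O L')
    {M : Set ℕ+} (hM : M.Infinite) :
    ∃ N ⊆ M, N.Infinite ∧
      ((∀ L ⊆ N, L.Infinite → O L) ∨ (∀ L ⊆ N, L.Infinite → ¬ O L)) := by
  classical
  -- `P` accepts `s` if `s ∪ L` is in `O` for all infinite `L ⊆ P` beyond `s`.
  let acc : Finset ℕ+ → Set ℕ+ → Prop := fun s P =>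
    ∀ L ⊆ after P s, L.Infinite → O (↑s ∪ L)
  let rej : Finset ℕ+ → Set ℕ+ → Prop := fun s P => ∀ P' ⊆ P, P'.Infinite → ¬ acc s P'
  have hacc : ∀ s, Hereditary (acc s) := fun s P P' h hP L hL => hP L (hL.trans (after_mono h s))
  have hrej : ∀ s, Hereditary (rej s) := fun s P P' h hP R hR => hP R (hR.trans h)
  obtain ⟨N, hNM, hN, hdec⟩ := exists_diagonal hM (Q := fun s P => acc s P ∨ rej s P)
    (fun s P P' h => Or.imp (hacc s P P' h) (hrej s P P' h))
    (fun s P _ hi => by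
      by_cases h : rej s P
      · exact ⟨P, subset_rfl, hi, Or.inr h⟩
      · simp only [rej] at h
        push Not at h
        obtain ⟨P', h1, h2, h3⟩ := h
        exact ⟨P', h1, h2, Or.inl h3⟩)
  have haft : ∀ s (P : Set ℕ+), acc s (after P s) → acc s P := fun s P h L hL =>
    h L fun m hm => ⟨hL hm, (hL hm).2⟩
  -- A rejected set stays rejected after the adjunction of almost every element of `N`.
  have key : ∀ s : Finset ℕ+, ↑s ⊆ N → rej s (after N s) →
      {n ∈ after N s | acc (insert n s) (after N (insert n s))}.Finite := by
    intro s _ hr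
    by_contra hinf
    refine hr _ (fun m hm => hm.1) hinf fun L hL hLi => ?_
    set n := minElt L with hn
    have hnL : n ∈ L := minElt_mem hLi.nonempty
    have h1 := (hL hnL).1.2
    have h2 := haft _ _ h1 (L \ {n}) ?_ (hLi.sdiff (Set.finite_singleton n))
    · convert h2 using 1
      ext m
      by_cases hmn : m = n
      · subst hmn; simp [hnL]
      · simp [hmn]
    · rintro m ⟨hm, hmn⟩
      refine ⟨(hL hm).1.1.1, fun k hk => ?_⟩
      rcases Finset.mem_insert.1 hk with rfl | hk
      · exact lt_of_le_of_ne (minElt_le hm) (fun h => hmn h.symm)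
      · exact (hL hm).2 k hk
  obtain ⟨N', hN'N, hN', hstay⟩ := exists_diagonal hN
    (Q := fun s P => ↑s ⊆ N → rej s (after N s) →
      ∀ n ∈ P, n ∈ after N s → rej (insert n s) (after N (insert n s)))
    (fun s P P' h hQ h1 h2 n hn => hQ h1 h2 n (h hn))
    (fun s P hP hi => by
      by_cases h : ↑s ⊆ N ∧ rej s (after N s)
      · refine ⟨P \ {n ∈ after N s | acc (insert n s) (after N (insert n s))},
          Set.sdiff_subset, hi.sdiff (key s h.1 h.2), fun _ _ n hn hna => ?_⟩
        refine (hdec (insert n s) ?_).resolve_left fun hh => hn.2 ⟨hna, hh⟩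
        intro k hk
        rcases Finset.mem_insert.1 hk with rfl | hk
        · exact hna.1
        · exact h.1 hk
      · exact ⟨P, subset_rfl, hi, fun h1 h2 => (h ⟨h1, h2⟩).elim⟩)
  rcases hdec ∅ (by simp) with h0 | h0
  · refine ⟨N, hNM, hN, Or.inl fun L hL hi => ?_⟩
    have := haft _ _ h0 L (by rwa [after_empty]) hi
    simpa using this
  · refine ⟨N', hN'N.trans hNM, hN', Or.inr fun L hL hi hOL => ?_⟩
    have hall : ∀ s : Finset ℕ+, ↑s ⊆ N' → rej s (after N s) := by
      intro s
      induction s using Finset.induction_on_max with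
      | empty => exact fun _ => h0
      | insert n s hlt ih =>
        intro hs
        have hs' : ↑s ⊆ N' := fun k hk => hs (Finset.mem_insert_of_mem hk)
        have hn : n ∈ N' := hs (Finset.mem_insert_self _ _)
        exact hstay s hs' (hs'.trans hN'N) (ih hs') n ⟨hn, hlt⟩ ⟨hN'N hn, hlt⟩
    obtain ⟨n, hn⟩ := hO L hi hOL
    set s : Finset ℕ+ := (Finset.Iic n).filter (· ∈ L) with hs
    have hsL : ∀ k, k ∈ s ↔ k ≤ n ∧ k ∈ L := fun k => by simp [hs]
    have hsN : ↑s ⊆ N' := fun k hk => hL ((hsL k).1 hk).2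
    refine hall s hsN (after (after N s) {n}) (after_subset _ _)
      (after_infinite (after_infinite hN _) _) fun R hR hRi => hn _ ?_ fun k hk => ?_
    · exact hRi.mono Set.subset_union_right
    · constructor
      · exact fun h => Or.inl ((hsL k).2 ⟨hk, h⟩)
      · rintro (h | h)
        · exact ((hsL k).1 h).2
        · exact absurd hk (not_le.2 ((hR h).1.2 n (Finset.mem_singleton_self n)))

/-! ### Structure of the repeated averages -/

lemma minElt_congr {L L' : Set ℕ+} (hL : L.Infinite) {n : ℕ+} (h : AgreeUpTo n L L')
    (hle : minElt L ≤ n) : minElt L' = minElt L := by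
  refine minElt_eq ((h _ hle).1 (minElt_mem hL.nonempty)) fun k hk => ?_
  by_contra hlt
  exact hlt (minElt_le ((h k ((not_le.1 hlt).le.trans hle)).2 hk))

/-- The properties of a map `L ↦ f L` from infinite sets to probability measures which carry the
induction on repeated averages: `f L` is a probability measure whose support is a nonempty initial
segment of `L`, and `f L` depends only on that initial segment. -/
structure IsInitialAverage (f : Set ℕ+ → (ℕ+ →₀ ℝ)) : Prop where
  subset : ∀ {L : Set ℕ+}, L.Infinite → ↑(f L).support ⊆ L
  nonempty : ∀ {L : Set ℕ+}, L.Infinite → (f L).support.Nonempty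
  initial : ∀ {L : Set ℕ+}, L.Infinite → ∀ k ∈ (f L).support, ∀ j ∈ L, j ≤ k → j ∈ (f L).support
  nonneg : ∀ {L : Set ℕ+}, L.Infinite → ∀ k, 0 ≤ f L k
  sum_eq : ∀ {L : Set ℕ+}, L.Infinite → ∀ F : Finset ℕ+, (f L).support ⊆ F → ∑ k ∈ F, f L k = 1
  congr : ∀ {L L' : Set ℕ+}, L.Infinite → L'.Infinite → ∀ n, (∀ k ∈ (f L).support, k ≤ n) →
    AgreeUpTo n L L' → f L' = f L

/-- What is left of `L` when the supports of the first `n` averages have been removed. -/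
def rest (f : Set ℕ+ → (ℕ+ →₀ ℝ)) (L : Set ℕ+) : ℕ → Set ℕ+
  | 0 => L
  | n + 1 => after L (iterateFirst f L n).support

lemma iterateFirst_eq (f : Set ℕ+ → (ℕ+ →₀ ℝ)) (L : Set ℕ+) (n : ℕ) :
    iterateFirst f L n = f (rest f L n) := by
  cases n <;> rfl

namespace IsInitialAverage

variable {f : Set ℕ+ → (ℕ+ →₀ ℝ)} {L : Set ℕ+}

lemma minElt_mem_support (hf : IsInitialAverage f) (hL : L.Infinite) :
    minElt L ∈ (f L).support := by
  obtain ⟨k, hk⟩ := hf.nonempty hL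
  exact hf.initial hL k hk _ (minElt_mem hL.nonempty) (minElt_le (hf.subset hL hk))

lemma sum_le_one (hf : IsInitialAverage f) (hL : L.Infinite) (F : Finset ℕ+) :
    ∑ k ∈ F, f L k ≤ 1 := by
  classical
  rw [← hf.sum_eq hL (F ∪ (f L).support) Finset.subset_union_right]
  exact Finset.sum_le_sum_of_subset_of_nonneg Finset.subset_union_left
    fun k _ _ => hf.nonneg hL k

lemma rest_infinite (hL : L.Infinite) (n : ℕ) : (rest f L n).Infinite := by
  cases n
  · exact hL
  · exact after_infinite hL _

lemma rest_subset (n : ℕ) : rest f L n ⊆ L := by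
  cases n
  · exact subset_rfl
  · exact after_subset _ _

lemma rest_succ (hf : IsInitialAverage f) (hL : L.Infinite) (n : ℕ) :
    rest f L (n + 1) = after (rest f L n) (f (rest f L n)).support := by
  obtain ⟨k, hk⟩ := hf.nonempty (rest_infinite (f := f) hL n)
  have hk' := hf.subset (rest_infinite (f := f) hL n) hk
  ext m
  rw [rest, iterateFirst_eq]
  refine ⟨fun hm => ⟨?_, hm.2⟩, fun hm => ⟨rest_subset n hm.1, hm.2⟩⟩
  have hkm := hm.2 k hk
  cases n with
  | zero => exact hm.1
  | succ n => exact ⟨hm.1, fun j hj => (hk'.2 j hj).trans hkm⟩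

lemma rest_antitone (hf : IsInitialAverage f) (hL : L.Infinite) : Antitone (rest f L) :=
  antitone_nat_of_succ_le fun n => by rw [hf.rest_succ hL]; exact after_subset _ _

lemma rest_add_one (hf : IsInitialAverage f) (hL : L.Infinite) (n : ℕ) :
    rest f L (n + 1) = rest f (rest f L 1) n := by
  induction n with
  | zero => rfl
  | succ n ih => rw [hf.rest_succ hL, ih, hf.rest_succ (rest_infinite hL 1)]

lemma iterateFirst_add_one (hf : IsInitialAverage f) (hL : L.Infinite) (n : ℕ) :
    iterateFirst f L (n + 1) = iterateFirst f (after L (f L).support) n := by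
  rw [iterateFirst_eq, iterateFirst_eq, hf.rest_add_one hL]
  rfl

lemma support_subset_rest (hf : IsInitialAverage f) (hL : L.Infinite) (n : ℕ) :
    ↑(iterateFirst f L n).support ⊆ rest f L n := by
  rw [iterateFirst_eq]
  exact hf.subset (rest_infinite hL n)

lemma support_subset (hf : IsInitialAverage f) (hL : L.Infinite) (n : ℕ) :
    ↑(iterateFirst f L n).support ⊆ L :=
  (hf.support_subset_rest hL n).trans (rest_subset n)

lemma support_nonempty (hf : IsInitialAverage f) (hL : L.Infinite) (n : ℕ) :
    (iterateFirst f L n).support.Nonempty := by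
  rw [iterateFirst_eq]
  exact hf.nonempty (rest_infinite hL n)

lemma iterateFirst_nonneg (hf : IsInitialAverage f) (hL : L.Infinite) (n : ℕ) (k : ℕ+) :
    0 ≤ iterateFirst f L n k := by
  rw [iterateFirst_eq]
  exact hf.nonneg (rest_infinite hL n) k

lemma iterateFirst_sum_le_one (hf : IsInitialAverage f) (hL : L.Infinite) (n : ℕ)
    (F : Finset ℕ+) : ∑ k ∈ F, iterateFirst f L n k ≤ 1 := by
  rw [iterateFirst_eq]
  exact hf.sum_le_one (rest_infinite hL n) F

lemma support_lt (hf : IsInitialAverage f) (hL : L.Infinite) {i j : ℕ} (hij : i < j) {p q : ℕ+}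
    (hp : p ∈ (iterateFirst f L i).support) (hq : q ∈ (iterateFirst f L j).support) : p < q :=
  (hf.rest_antitone hL (Nat.succ_le_of_lt hij) (hf.support_subset_rest hL j hq)).2 p hp

lemma nat_lt_of_mem_rest (hf : IsInitialAverage f) (hL : L.Infinite) (n : ℕ) :
    ∀ m ∈ rest f L n, n < (m : ℕ) := by
  induction n with
  | zero => exact fun m _ => m.pos
  | succ n ih =>
    intro m hm
    obtain ⟨k, hk⟩ := hf.support_nonempty hL n
    have h1 := ih k (hf.support_subset_rest hL n hk)
    have h2 : (k : ℕ) < m := hm.2 k hk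
    omega

lemma mem_rest_or (hf : IsInitialAverage f) (hL : L.Infinite) {j : ℕ+} (hj : j ∈ L) (i : ℕ) :
    j ∈ rest f L i ∨ ∃ i' < i, j ∈ (iterateFirst f L i').support := by
  induction i with
  | zero => exact Or.inl hj
  | succ i ih =>
    rcases ih with ih | ⟨i', hi', h⟩
    · by_cases hs : j ∈ (iterateFirst f L i).support
      · exact Or.inr ⟨i, i.lt_succ_self, hs⟩
      · left
        rw [hf.rest_succ hL]
        rw [iterateFirst_eq] at hs
        refine ⟨ih, fun k hk => ?_⟩
        by_contra hkj
        exact hs (hf.initial (rest_infinite hL i) k hk j ih (not_lt.1 hkj))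
    · exact Or.inr ⟨i', hi'.trans i.lt_succ_self, h⟩

lemma exists_mem_support (hf : IsInitialAverage f) (hL : L.Infinite) {i : ℕ} {j k : ℕ+}
    (hk : k ∈ (iterateFirst f L i).support) (hj : j ∈ L) (hjk : j ≤ k) :
    ∃ i' ≤ i, j ∈ (iterateFirst f L i').support := by
  rcases hf.mem_rest_or hL hj i with h | ⟨i', hi', h⟩
  · refine ⟨i, le_rfl, ?_⟩
    rw [iterateFirst_eq] at hk ⊢
    exact hf.initial (rest_infinite hL i) k hk j h hjk
  · exact ⟨i', hi'.le, h⟩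

lemma agreeUpTo_after {n : ℕ+} {L L' : Set ℕ+} (h : AgreeUpTo n L L') (s : Finset ℕ+) :
    AgreeUpTo n (after L s) (after L' s) := fun k hk => by
  simp only [after, Set.mem_ofPred_eq, h k hk]

lemma iterateFirst_congr (hf : IsInitialAverage f) {n : ℕ+} (i : ℕ) :
    ∀ {L L' : Set ℕ+}, L.Infinite → L'.Infinite → (∀ k ∈ (iterateFirst f L i).support, k ≤ n) →
      AgreeUpTo n L L' → iterateFirst f L' i = iterateFirst f L i := by
  induction i with
  | zero => exact fun hL hL' hn h => hf.congr hL hL' n hn h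
  | succ i ih =>
    intro L L' hL hL' hn h
    obtain ⟨q, hq⟩ := hf.support_nonempty hL (i + 1)
    have h1 : f L' = f L := hf.congr hL hL' n (fun k hk =>
      (hf.support_lt hL (Nat.succ_pos i) hk hq).le.trans (hn q hq)) h
    rw [hf.iterateFirst_add_one hL] at hn
    rw [hf.iterateFirst_add_one hL, hf.iterateFirst_add_one hL', h1]
    exact ih (after_infinite hL _) (after_infinite hL' _) hn (agreeUpTo_after h _)

/-- The first `k` averages depend on finitely many elements of `L` only. -/
lemma exists_agreeUpTo (hf : IsInitialAverage f) (hL : L.Infinite) (k : ℕ) :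
    ∃ n, ∀ L' : Set ℕ+, L'.Infinite → AgreeUpTo n L L' →
      ∀ i < k, iterateFirst f L' i = iterateFirst f L i := by
  classical
  refine ⟨((Finset.range k).biUnion fun i => (iterateFirst f L i).support).sup id,
    fun L' hL' h i hi => hf.iterateFirst_congr i hL hL' (fun j hj => ?_) h⟩
  exact Finset.le_sup (f := id) (Finset.mem_biUnion.2 ⟨i, Finset.mem_range.2 hi, hj⟩)

/-- Every subsequence of the sequence of averages of `L` is the sequence of averages of the union
of its supports. -/
lemma exists_subsequence (hf : IsInitialAverage f) (hL : L.Infinite) {i : ℕ → ℕ}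
    (hi : StrictMono i) :
    ∃ L' ⊆ L, L'.Infinite ∧ ∀ n, iterateFirst f L' n = iterateFirst f L (i n) := by
  -- `U n` is what remains of the union of supports after `n` steps.
  let U : ℕ → Set ℕ+ := fun n => {m | ∃ j ≥ n, m ∈ (iterateFirst f L (i j)).support}
  have hUinf : ∀ n, (U n).Infinite := by
    intro n
    refine Set.infinite_of_forall_exists_gt fun a => ?_
    obtain ⟨q, hq⟩ := hf.support_nonempty hL (i (max n a))
    refine ⟨q, ⟨_, le_max_left _ _, hq⟩, ?_⟩
    have h1 := hf.nat_lt_of_mem_rest hL _ q (hf.support_subset_rest hL _ hq)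
    have h2 := hi.le_apply (x := max n a)
    have h3 : (a : ℕ) < q := by omega
    exact h3
  have hfU : ∀ n, f (U n) = iterateFirst f L (i n) := by
    intro n
    rw [iterateFirst_eq]
    refine hf.congr (rest_infinite hL _) (hUinf n) ((f (rest f L (i n))).support.sup id)
      (fun k hk => Finset.le_sup (f := id) hk) fun k hk => ?_
    obtain ⟨q, hq, hkq⟩ : ∃ q ∈ (f (rest f L (i n))).support, k ≤ q := by
      have hne := hf.nonempty (rest_infinite (f := f) hL (i n))
      refine ⟨_, Finset.max'_mem _ hne, ?_⟩
      rwa [Finset.max'_eq_sup', Finset.sup'_eq_sup]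
    constructor
    · intro h
      refine ⟨n, le_rfl, ?_⟩
      rw [iterateFirst_eq]
      exact hf.initial (rest_infinite hL _) q hq k h hkq
    · rintro ⟨j, hj, h⟩
      exact hf.rest_antitone hL (hi.monotone hj) (hf.support_subset_rest hL _ h)
  have hrest : ∀ n, rest f (U 0) n = U n := by
    intro n
    induction n with
    | zero => rfl
    | succ n ih =>
      rw [hf.rest_succ (hUinf 0), ih, hfU]
      ext m
      constructor
      · rintro ⟨⟨j, hj, hm⟩, h⟩
        rcases eq_or_lt_of_le hj with rfl | hj
        · exact absurd (h m hm) (lt_irrefl _)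
        · exact ⟨j, hj, hm⟩
      · rintro ⟨j, hj, hm⟩
        exact ⟨⟨j, (Nat.le_succ n).trans hj, hm⟩,
          fun k hk => hf.support_lt hL (hi (Nat.lt_of_succ_le hj)) hk hm⟩
  refine ⟨U 0, ?_, hUinf 0, fun n => by rw [iterateFirst_eq, hrest, hfU]⟩
  rintro m ⟨j, _, hm⟩
  exact hf.support_subset hL _ hm

end IsInitialAverage

/-- The successor step in the definition of the repeated averages. -/
noncomputable def averageSucc (f : Set ℕ+ → (ℕ+ →₀ ℝ)) (M : Set ℕ+) : ℕ+ →₀ ℝ :=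
  (((minElt M : ℕ) : ℝ)⁻¹) • ∑ i ∈ Finset.range (minElt M : ℕ), iterateFirst f M i

lemma averageSucc_apply (f : Set ℕ+ → (ℕ+ →₀ ℝ)) (M : Set ℕ+) (k : ℕ+) :
    averageSucc f M k =
      ((minElt M : ℕ) : ℝ)⁻¹ * ∑ i ∈ Finset.range (minElt M : ℕ), iterateFirst f M i k := by
  simp [averageSucc]

lemma sum_averageSucc (f : Set ℕ+ → (ℕ+ →₀ ℝ)) (M : Set ℕ+) (F : Finset ℕ+) :
    ∑ k ∈ F, averageSucc f M k = ((minElt M : ℕ) : ℝ)⁻¹ *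
      ∑ i ∈ Finset.range (minElt M : ℕ), ∑ k ∈ F, iterateFirst f M i k := by
  simp only [averageSucc_apply]
  rw [← Finset.mul_sum, Finset.sum_comm]

namespace IsInitialAverage

variable {f : Set ℕ+ → (ℕ+ →₀ ℝ)} {L : Set ℕ+}

lemma mem_support_averageSucc (hf : IsInitialAverage f) (hL : L.Infinite) (k : ℕ+) :
    k ∈ (averageSucc f L).support ↔
      ∃ i < (minElt L : ℕ), k ∈ (iterateFirst f L i).support := by
  have h0 : (((minElt L : ℕ) : ℝ)⁻¹) ≠ 0 := inv_ne_zero (Nat.cast_ne_zero.2 (minElt L).ne_zero)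
  simp only [Finsupp.mem_support_iff, averageSucc_apply, ne_eq, mul_eq_zero, h0, false_or]
  rw [Finset.sum_eq_zero_iff_of_nonneg fun i _ => hf.iterateFirst_nonneg hL i k]
  simp

lemma succ (hf : IsInitialAverage f) : IsInitialAverage (averageSucc f) where
  subset hL k hk := by
    obtain ⟨i, _, h⟩ := (hf.mem_support_averageSucc hL k).1 hk
    exact hf.support_subset hL i h
  nonempty {L} hL := by
    obtain ⟨q, hq⟩ := hf.support_nonempty hL 0
    exact ⟨q, (hf.mem_support_averageSucc hL q).2 ⟨0, (minElt L).pos, hq⟩⟩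
  initial hL k hk j hj hjk := by
    obtain ⟨i, hi, h⟩ := (hf.mem_support_averageSucc hL k).1 hk
    obtain ⟨i', hi', h'⟩ := hf.exists_mem_support hL h hj hjk
    exact (hf.mem_support_averageSucc hL j).2 ⟨i', hi'.trans_lt hi, h'⟩
  nonneg hL k := by
    rw [averageSucc_apply]
    exact mul_nonneg (by positivity) (Finset.sum_nonneg fun i _ => hf.iterateFirst_nonneg hL i k)
  sum_eq {L} hL F hF := by
    have h0 : ((minElt L : ℕ) : ℝ) ≠ 0 := Nat.cast_ne_zero.2 (minElt L).ne_zero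
    rw [sum_averageSucc, Finset.sum_congr rfl (g := fun _ => (1 : ℝ))]
    · simp [h0]
    · intro i hi
      rw [iterateFirst_eq]
      refine hf.sum_eq (rest_infinite hL i) F fun k hk => hF ?_
      rw [← iterateFirst_eq f L i] at hk
      exact (hf.mem_support_averageSucc hL k).2 ⟨i, Finset.mem_range.1 hi, hk⟩
  congr {L L'} hL hL' n hn h := by
    have hmem : minElt L ∈ (averageSucc f L).support := (hf.mem_support_averageSucc hL _).2
      ⟨0, (minElt L).pos, hf.minElt_mem_support hL⟩
    have hmin := minElt_congr hL h (hn _ hmem)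
    rw [averageSucc, averageSucc, hmin]
    congr 1
    refine Finset.sum_congr rfl fun i hi => hf.iterateFirst_congr i hL hL' (fun k hk => ?_) h
    exact hn k ((hf.mem_support_averageSucc hL k).2 ⟨i, Finset.mem_range.1 hi, hk⟩)

end IsInitialAverage

lemma isInitialAverage_single :
    IsInitialAverage fun L => Finsupp.single (minElt L) (1 : ℝ) := by
  have hs : ∀ m : ℕ+, (Finsupp.single m (1 : ℝ)).support = {m} := fun m =>
    Finsupp.support_single _ one_ne_zero
  refine ⟨fun hL k hk => ?_, fun hL => ?_, fun hL k hk j hj hjk => ?_, fun hL k => ?_,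
    fun hL F hF => ?_, fun {L L'} hL hL' n hn h => ?_⟩
  · rw [hs] at hk
    rw [Finset.mem_singleton.1 hk]
    exact minElt_mem hL.nonempty
  · rw [hs]
    exact Finset.singleton_nonempty _
  · rw [hs, Finset.mem_singleton] at hk ⊢
    exact le_antisymm (hk ▸ hjk) (minElt_le hj)
  · exact Finsupp.single_nonneg.2 zero_le_one k
  · rw [hs, Finset.singleton_subset_iff] at hF
    simp [Finsupp.single_apply, hF]
  · have hle : minElt L ≤ n := hn _ (by rw [hs]; exact Finset.mem_singleton_self _)
    have hmin := minElt_congr hL h hle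
    simp only [hmin]

variable (A : AssociatedSequences)

lemma AssociatedSequences.lt {ξ : Ordinal.{0}} (hξ : ξ < ω₁) (h : Order.IsSuccLimit ξ) (n : ℕ+) :
    A.seq ξ n + 1 < ξ :=
  (A.strictMono ξ hξ h (PNat.lt_add_right n 1)).trans_le
    ((A.isLUB ξ hξ h).1 ⟨n + 1, rfl⟩)

lemma firstAverage_zero : firstAverage A 0 = fun L => Finsupp.single (minElt L) (1 : ℝ) := by
  rw [firstAverage, Ordinal.limitRecOn_zero]

lemma firstAverage_add_one (ζ : Ordinal.{0}) :
    firstAverage A (ζ + 1) = averageSucc (firstAverage A ζ) := by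
  rw [firstAverage, Ordinal.limitRecOn_add_one]
  rfl

lemma firstAverage_limit {ξ : Ordinal.{0}} (hξ : ξ < ω₁) (h : Order.IsSuccLimit ξ) (L : Set ℕ+) :
    firstAverage A ξ L = firstAverage A (A.seq ξ (minElt L) + 1) L := by
  rw [firstAverage, Ordinal.limitRecOn_limit _ _ _ _ h]
  simp only [dif_pos (A.lt hξ h (minElt L))]
  rfl

/-- Induction on countable ordinals along the recursion defining the repeated averages. -/
theorem countable_induction {p : Ordinal.{0} → Prop} (zero : p 0)
    (succ : ∀ ζ, ζ + 1 < ω₁ → p ζ → p (ζ + 1))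
    (limit : ∀ ξ, ξ < ω₁ → Order.IsSuccLimit ξ → (∀ ζ < ξ, p ζ) → p ξ)
    (ξ : Ordinal.{0}) (hξ : ξ < ω₁) : p ξ := by
  induction ξ using Ordinal.limitRecOn with
  | zero => exact zero
  | add_one ζ ih => exact succ ζ hξ (ih ((lt_add_one ζ).trans hξ))
  | limit ξ h ih => exact limit ξ hξ h fun ζ hζ => ih ζ hζ (hζ.trans hξ)

theorem isInitialAverage_firstAverage (ξ : Ordinal.{0}) (hξ : ξ < ω₁) :
    IsInitialAverage (firstAverage A ξ) := by
  refine countable_induction (p := fun ξ => IsInitialAverage (firstAverage A ξ)) ?_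
    (fun ζ _ ih => ?_) (fun ξ hξ h ih => ?_) ξ hξ
  · rw [firstAverage_zero]; exact isInitialAverage_single
  · rw [firstAverage_add_one]; exact ih.succ
  · have hi : ∀ n, IsInitialAverage (firstAverage A (A.seq ξ n + 1)) :=
      fun n => ih _ (A.lt hξ h n)
    refine ⟨fun hL => ?_, fun hL => ?_, fun hL => ?_, fun hL => ?_, fun hL => ?_,
      fun {L L'} hL hL' n hn hag => ?_⟩
    · rw [firstAverage_limit A hξ h]; exact (hi _).subset hL
    · rw [firstAverage_limit A hξ h]; exact (hi _).nonempty hL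
    · rw [firstAverage_limit A hξ h]; exact (hi _).initial hL
    · rw [firstAverage_limit A hξ h]; exact (hi _).nonneg hL
    · rw [firstAverage_limit A hξ h]; exact (hi _).sum_eq hL
    · rw [firstAverage_limit A hξ h] at hn
      have hle : minElt L ≤ n := hn _ ((hi _).minElt_mem_support hL)
      have hmin := minElt_congr hL hag hle
      rw [firstAverage_limit A hξ h, firstAverage_limit A hξ h, hmin]
      exact (hi _).congr hL hL' n hn hag

/-! ### Schreier families -/

/-- The unions of `k` successive, possibly empty, members of `S`. -/
def blocks (S : Set (Finset ℕ+)) : ℕ → Set (Finset ℕ+)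
  | 0 => {∅}
  | k + 1 => {F | ∃ G ∈ S, ∃ H ∈ blocks S k, (∀ p ∈ G, ∀ q ∈ H, p < q) ∧ F = G ∪ H}

section blocks

variable {S : Set (Finset ℕ+)}

lemma empty_mem_blocks (h0 : ∅ ∈ S) (k : ℕ) : ∅ ∈ blocks S k := by
  induction k with
  | zero => rfl
  | succ k ih => exact ⟨∅, h0, ∅, ih, by simp, by simp⟩

lemma biUnion_mem_blocks {k : ℕ} (G : Fin k → Finset ℕ+) (hS : ∀ i, G i ∈ S)
    (hlt : ∀ i j, i < j → ∀ p ∈ G i, ∀ q ∈ G j, p < q) :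
    Finset.univ.biUnion G ∈ blocks S k := by
  induction k with
  | zero => rfl
  | succ k ih =>
    refine ⟨G 0, hS 0, _, ih (fun i => G i.succ) (fun i => hS _)
      (fun i j h => hlt _ _ (Fin.succ_lt_succ_iff.2 h)), fun p hp q hq => ?_, ?_⟩
    · obtain ⟨i, _, hi⟩ := Finset.mem_biUnion.1 hq
      exact hlt 0 i.succ (Fin.succ_pos i) p hp q hi
    · ext p
      simp [Fin.exists_fin_succ]

lemma exists_nonempty_blocks {k : ℕ} {F : Finset ℕ+} (hF : F ∈ blocks S k) :
    ∃ n ≤ k, ∃ G : Fin n → Finset ℕ+, (∀ i, G i ∈ S ∧ (G i).Nonempty) ∧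
      (∀ i j, i < j → ∀ p ∈ G i, ∀ q ∈ G j, p < q) ∧ F = Finset.univ.biUnion G := by
  induction k generalizing F with
  | zero => exact ⟨0, le_rfl, Fin.elim0, fun i => i.elim0, fun i => i.elim0, hF⟩
  | succ k ih =>
    obtain ⟨G₀, h₀, H, hH, hlt, rfl⟩ := hF
    obtain ⟨n, hn, G, hG, hGlt, rfl⟩ := ih hH
    rcases G₀.eq_empty_or_nonempty with rfl | hne
    · exact ⟨n, hn.trans k.le_succ, G, hG, hGlt, by simp⟩
    · refine ⟨n + 1, Nat.succ_le_succ hn, Fin.cons G₀ G, fun i => ?_, fun i j => ?_, ?_⟩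
      · refine Fin.cases ⟨h₀, hne⟩ (fun i => ?_) i
        simpa using hG i
      · refine Fin.cases (fun h p hp q hq => ?_) (fun j h p hp q hq => ?_) j
        · exact absurd h (Fin.not_lt_zero i)
        · revert h hp
          refine Fin.cases (fun _ hp => ?_) (fun i h hp => ?_) i
          · exact hlt p hp q (Finset.mem_biUnion.2 ⟨j, Finset.mem_univ _, hq⟩)
          · exact hGlt i j (Fin.succ_lt_succ_iff.1 h) p hp q hq
      · ext p
        simp [Fin.exists_fin_succ]

lemma mem_schreierSucc_iff (h0 : ∅ ∈ S) {F : Finset ℕ+} :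
    F ∈ schreierSucc S ↔ ∃ n : ℕ+, (∀ p ∈ F, n ≤ p) ∧ F ∈ blocks S n := by
  constructor
  · rintro (⟨n, G, hG, hlt, hn, rfl⟩ | rfl)
    · refine ⟨n, fun p hp => ?_, biUnion_mem_blocks G (fun i => (hG i).1) hlt⟩
      obtain ⟨i, _, hi⟩ := Finset.mem_biUnion.1 hp
      exact hn i p hi
    · exact ⟨1, by simp, empty_mem_blocks h0 _⟩
  · rintro ⟨n, hn, hF⟩
    obtain ⟨k, hk, G, hG, hlt, rfl⟩ := exists_nonempty_blocks hF
    rcases Nat.eq_zero_or_pos k with rfl | hpos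
    · exact Or.inr (by simp)
    · refine Or.inl ⟨⟨k, hpos⟩, G, hG, hlt, fun i p hp => le_trans ?_
        (hn p (Finset.mem_biUnion.2 ⟨i, Finset.mem_univ _, hp⟩)), rfl⟩
      exact hk

/-- A family of finite sets is closed under spreading and subsets if it contains every finite set
`F` that is mapped into a member of the family by a strictly increasing map lowering the
elements of `F`. -/
def SpreadClosed (S : Set (Finset ℕ+)) : Prop :=
  ∀ ⦃F G : Finset ℕ+⦄ ⦃ψ : ℕ+ → ℕ+⦄, G ∈ S → StrictMonoOn ψ F → (∀ p ∈ F, ψ p ∈ G) →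
    (∀ p ∈ F, ψ p ≤ p) → F ∈ S

lemma SpreadClosed.blocks (hS : SpreadClosed S) (k : ℕ) : SpreadClosed (blocks S k) := by
  induction k with
  | zero =>
    intro F G ψ hG _ hm _
    obtain rfl : G = ∅ := hG
    exact Finset.eq_empty_of_forall_notMem fun p hp => absurd (hm p hp) (Finset.notMem_empty _)
  | succ k ih =>
    rintro F _ ψ ⟨G, hG, H, hH, hlt, rfl⟩ hmono hm hle
    refine ⟨F.filter (ψ · ∈ G), hS hG (hmono.mono (Finset.filter_subset _ _))
      (fun p hp => (Finset.mem_filter.1 hp).2) (fun p hp => hle p (Finset.mem_filter.1 hp).1),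
      F.filter (ψ · ∉ G), ih hH (hmono.mono (Finset.filter_subset _ _)) (fun p hp => ?_)
      (fun p hp => hle p (Finset.mem_filter.1 hp).1), fun p hp q hq => ?_,
      (Finset.filter_union_filter_not_eq _ _).symm⟩
    · rw [Finset.mem_filter] at hp
      exact (Finset.mem_union.1 (hm p hp.1)).resolve_left hp.2
    · rw [Finset.mem_filter] at hp hq
      exact (hmono.lt_iff_lt hp.1 hq.1).1
        (hlt _ hp.2 _ ((Finset.mem_union.1 (hm q hq.1)).resolve_left hq.2))

end blocks

lemma mem_schreier_zero {F : Finset ℕ+} : F ∈ schreier A 0 ↔ F = ∅ ∨ ∃ n, F = {n} := by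
  rw [schreier, Ordinal.limitRecOn_zero]
  rfl

lemma schreier_add_one (ζ : Ordinal.{0}) :
    schreier A (ζ + 1) = schreierSucc (schreier A ζ) := by
  rw [schreier, Ordinal.limitRecOn_add_one]
  rfl

lemma mem_schreier_limit {ξ : Ordinal.{0}} (hξ : ξ < ω₁) (h : Order.IsSuccLimit ξ)
    {F : Finset ℕ+} :
    F ∈ schreier A ξ ↔ ∃ n : ℕ+, (∀ p ∈ F, n ≤ p) ∧ F ∈ schreier A (A.seq ξ n + 1) := by
  rw [schreier, Ordinal.limitRecOn_limit _ _ _ _ h]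
  exact ⟨fun ⟨n, hn, _, hF⟩ => ⟨n, hn, hF⟩, fun ⟨n, hn, hF⟩ => ⟨n, hn, A.lt hξ h n, hF⟩⟩

lemma empty_mem_schreier (ξ : Ordinal.{0}) (hξ : ξ < ω₁) : ∅ ∈ schreier A ξ := by
  refine countable_induction (p := fun ξ => ∅ ∈ schreier A ξ) ?_
    (fun ζ _ _ => ?_) (fun ξ hξ h ih => ?_) ξ hξ
  · exact (mem_schreier_zero A).2 (Or.inl rfl)
  · rw [schreier_add_one]
    exact Or.inr rfl
  · exact (mem_schreier_limit A hξ h).2 ⟨1, by simp, ih _ (A.lt hξ h 1)⟩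

lemma mem_schreier_add_one {ζ : Ordinal.{0}} (hζ : ζ < ω₁) {F : Finset ℕ+} :
    F ∈ schreier A (ζ + 1) ↔
      ∃ n : ℕ+, (∀ p ∈ F, n ≤ p) ∧ F ∈ blocks (schreier A ζ) n := by
  rw [schreier_add_one, mem_schreierSucc_iff (empty_mem_schreier A ζ hζ)]

lemma schreier_subset_add_one {ζ : Ordinal.{0}} (hζ : ζ < ω₁) :
    schreier A ζ ⊆ schreier A (ζ + 1) := fun F hF =>
  (mem_schreier_add_one A hζ).2 ⟨1, fun p _ => one_le, F, hF, ∅, rfl, by simp, by simp⟩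

lemma singleton_mem_schreier (i : ℕ+) (ξ : Ordinal.{0}) (hξ : ξ < ω₁) :
    {i} ∈ schreier A ξ := by
  refine countable_induction (p := fun ξ => {i} ∈ schreier A ξ) ?_
    (fun ζ hζ ih => ?_) (fun ξ hξ h ih => ?_) ξ hξ
  · exact (mem_schreier_zero A).2 (Or.inr ⟨i, rfl⟩)
  · exact schreier_subset_add_one A ((lt_add_one ζ).trans hζ) ih
  · exact (mem_schreier_limit A hξ h).2 ⟨1, fun p _ => one_le, ih _ (A.lt hξ h 1)⟩

lemma spreadClosed_schreier (ξ : Ordinal.{0}) (hξ : ξ < ω₁) : SpreadClosed (schreier A ξ) := by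
  refine countable_induction (p := fun ξ => SpreadClosed (schreier A ξ)) ?_
    (fun ζ hζ ih => ?_) (fun ξ hξ h ih => ?_) ξ hξ
  · intro F G ψ hG hmono hm _
    rw [mem_schreier_zero] at hG ⊢
    rcases F.eq_empty_or_nonempty with rfl | ⟨p, hp⟩
    · exact Or.inl rfl
    · rcases hG with rfl | ⟨n, rfl⟩
      · exact absurd (hm p hp) (Finset.notMem_empty _)
      · refine Or.inr ⟨p, Finset.eq_singleton_iff_unique_mem.2 ⟨hp, fun q hq => ?_⟩⟩
        refine hmono.injOn hq hp ?_
        rw [Finset.mem_singleton.1 (hm p hp), Finset.mem_singleton.1 (hm q hq)]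
  · have hζ' := (lt_add_one ζ).trans hζ
    intro F G ψ hG hmono hm hle
    obtain ⟨n, hn, hG⟩ := (mem_schreier_add_one A hζ').1 hG
    exact (mem_schreier_add_one A hζ').2
      ⟨n, fun p hp => (hn _ (hm p hp)).trans (hle p hp), ih.blocks n hG hmono hm hle⟩
  · intro F G ψ hG hmono hm hle
    obtain ⟨n, hn, hG⟩ := (mem_schreier_limit A hξ h).1 hG
    exact (mem_schreier_limit A hξ h).2
      ⟨n, fun p hp => (hn _ (hm p hp)).trans (hle p hp), ih _ (A.lt hξ h n) hG hmono hm hle⟩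

/-- Up to finitely many integers, the Schreier families increase with the ordinal. -/
lemma exists_schreier_subset (ζ : Ordinal.{0}) (hζ : ζ < ω₁) :
    ∀ η ≤ ζ, ∃ n : ℕ+, ∀ F ∈ schreier A η, (∀ p ∈ F, n ≤ p) → F ∈ schreier A ζ := by
  refine countable_induction (p := fun ζ => ∀ η ≤ ζ, ∃ n : ℕ+, ∀ F ∈ schreier A η,
    (∀ p ∈ F, n ≤ p) → F ∈ schreier A ζ) (fun η hη => ?_)
    (fun ζ hζ ih η hη => ?_) (fun ξ hξ h ih η hη => ?_) ζ hζ
  · obtain rfl : η = 0 := le_antisymm hη zero_le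
    exact ⟨1, fun F hF _ => hF⟩
  · rcases eq_or_lt_of_le hη with rfl | hη
    · exact ⟨1, fun F hF _ => hF⟩
    · obtain ⟨n, hn⟩ := ih η (Order.lt_add_one_iff.1 hη)
      exact ⟨n, fun F hF h => schreier_subset_add_one A ((lt_add_one ζ).trans hζ) (hn F hF h)⟩
  · rcases eq_or_lt_of_le hη with rfl | hη
    · exact ⟨1, fun F hF _ => hF⟩
    · obtain ⟨_, ⟨k, rfl⟩, hk⟩ := (lt_isLUB_iff (A.isLUB ξ hξ h)).1 hη
      obtain ⟨n, hn⟩ := ih _ (A.lt hξ h k) η hk.le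
      exact ⟨max n k, fun F hF hm => (mem_schreier_limit A hξ h).2
        ⟨k, fun p hp => (le_max_right _ _).trans (hm p hp),
          hn F hF fun p hp => (le_max_left _ _).trans (hm p hp)⟩⟩

lemma support_firstAverage_mem_schreier (ξ : Ordinal.{0}) (hξ : ξ < ω₁) :
    ∀ L : Set ℕ+, L.Infinite → (firstAverage A ξ L).support ∈ schreier A ξ := by
  refine countable_induction (p := fun ξ => ∀ L : Set ℕ+, L.Infinite →
    (firstAverage A ξ L).support ∈ schreier A ξ) (fun L _ => ?_)
    (fun ζ hζ ih L hL => ?_) (fun ξ hξ h ih L hL => ?_) ξ hξ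
  · rw [firstAverage_zero, mem_schreier_zero]
    exact Or.inr ⟨minElt L, Finsupp.support_single _ one_ne_zero⟩
  · have hf := isInitialAverage_firstAverage A ζ ((lt_add_one ζ).trans hζ)
    rw [firstAverage_add_one, schreier_add_one]
    refine Or.inl ⟨minElt L, fun i => (iterateFirst (firstAverage A ζ) L i).support,
      fun i => ⟨?_, hf.support_nonempty hL i⟩, fun i j hij p hp q hq => hf.support_lt hL hij hp hq,
      fun i p hp => minElt_le (hf.support_subset hL i hp), ?_⟩
    · change (iterateFirst (firstAverage A ζ) L i).support ∈ _
      rw [iterateFirst_eq]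
      exact ih _ (IsInitialAverage.rest_infinite hL i)
    · ext k
      rw [hf.mem_support_averageSucc hL]
      simp only [Finset.mem_biUnion, Finset.mem_univ, true_and]
      exact ⟨fun ⟨i, hi, h⟩ => ⟨⟨i, hi⟩, h⟩, fun ⟨i, h⟩ => ⟨i, i.2, h⟩⟩
  · rw [firstAverage_limit A hξ h, mem_schreier_limit A hξ h]
    have hf := isInitialAverage_firstAverage A _ ((A.lt hξ h (minElt L)).trans hξ)
    exact ⟨minElt L, fun p hp => minElt_le (hf.subset hL hp), ih _ (A.lt hξ h _) L hL⟩

/-- The only one of the `min L` measures averaged by `averageSucc f L` which charges `min L` is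
the first. -/
lemma IsInitialAverage.averageSucc_minElt_le {f : Set ℕ+ → (ℕ+ →₀ ℝ)} (hf : IsInitialAverage f)
    {L : Set ℕ+} (hL : L.Infinite) :
    averageSucc f L (minElt L) ≤ ((minElt L : ℕ) : ℝ)⁻¹ := by
  rw [averageSucc_apply]
  refine mul_le_of_le_one_right (by positivity) ?_
  rw [Finset.sum_eq_single_of_mem 0 (Finset.mem_range.2 (minElt L).pos) fun i _ hi => ?_]
  · simpa using hf.iterateFirst_sum_le_one hL 0 {minElt L}
  · by_contra h
    exact lt_irrefl _ (hf.support_lt hL (Nat.pos_of_ne_zero hi) (hf.minElt_mem_support hL)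
      (Finsupp.mem_support_iff.2 h))

lemma firstAverage_minElt_le (ξ : Ordinal.{0}) (hξ : ξ < ω₁) (h1 : 1 ≤ ξ) {L : Set ℕ+}
    (hL : L.Infinite) : firstAverage A ξ L (minElt L) ≤ ((minElt L : ℕ) : ℝ)⁻¹ := by
  have hsucc : ∀ ζ, ζ + 1 < ω₁ →
      firstAverage A (ζ + 1) L (minElt L) ≤ ((minElt L : ℕ) : ℝ)⁻¹ := fun ζ hζ => by
    rw [firstAverage_add_one]
    exact (isInitialAverage_firstAverage A ζ
      ((lt_add_one ζ).trans hζ)).averageSucc_minElt_le hL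
  refine countable_induction (p := fun ξ => 1 ≤ ξ →
    firstAverage A ξ L (minElt L) ≤ ((minElt L : ℕ) : ℝ)⁻¹) (fun h => ?_)
    (fun ζ hζ _ _ => hsucc ζ hζ) (fun ξ hξ h _ _ => ?_) ξ hξ h1
  · exact absurd h (by simp)
  · rw [firstAverage_limit A hξ h]
    exact hsucc _ ((A.lt hξ h _).trans hξ)

/-! ### Families which are large for the repeated averages capture a Schreier family -/

/-- Every transport of the family `H` into `N` by a strictly increasing map lies in `𝓕`. -/
def Captured (H 𝓕 : Set (Finset ℕ+)) (N : Set ℕ+) : Prop :=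
  ∀ m : ℕ+ → ℕ+, StrictMono m → (∀ j, m j ∈ N) → ∀ F ∈ H, F.image m ∈ 𝓕

/-- The same as `Captured`, but restricted to the members of `H` beyond `p`, so that the values of
the transporting map up to `p` are irrelevant. -/
def CapturedAfter (H 𝓕 : Set (Finset ℕ+)) (p : ℕ) (N : Set ℕ+) : Prop :=
  ∀ m : ℕ+ → ℕ+, StrictMono m → (∀ j : ℕ+, p < (j : ℕ) → m j ∈ N) →
    ∀ F ∈ H, (∀ j ∈ F, p < (j : ℕ)) → F.image m ∈ 𝓕

lemma captured_hereditary (H 𝓕 : Set (Finset ℕ+)) : Hereditary (Captured H 𝓕) :=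
  fun _ _ h hP m hm hmP => hP m hm fun j => h (hmP j)

lemma capturedAfter_hereditary (H 𝓕 : Set (Finset ℕ+)) (p : ℕ) :
    Hereditary (CapturedAfter H 𝓕 p) :=
  fun _ _ h hP m hm hmP => hP m hm fun j hj => h (hmP j hj)

lemma exists_strictMono_mem {P : Set ℕ+} (hP : P.Infinite) :
    ∃ e : ℕ+ → ℕ+, StrictMono e ∧ ∀ j, e j ∈ P := by
  obtain ⟨φ, hφ, hmem⟩ := extraction_of_frequently_atTop (P := fun n : ℕ => n.succPNat ∈ P) <| by
    rw [frequently_atTop]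
    intro a
    obtain ⟨b, hb, hab⟩ := hP.exists_gt a.succPNat
    refine ⟨b.natPred, ?_, by simpa using hb⟩
    have h1 : a + 1 < (b : ℕ) := hab
    have h2 := PNat.natPred_add_one b
    omega
  refine ⟨fun j => (φ j.natPred).succPNat, fun i j hij => ?_, fun j => hmem _⟩
  exact Nat.succPNat_lt_succPNat.2 (hφ (PNat.natPred_lt_natPred.2 hij))

lemma _root_.StrictMono.nat_le_apply {m : ℕ+ → ℕ+} (hm : StrictMono m) (j : ℕ+) :
    (j : ℕ) ≤ m j := hm.le_apply (x := j)

/-- Beyond a set on which `H` is captured, the values of the transporting map up to `p` can be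
replaced by elements of that set. -/
lemma Captured.exists_capturedAfter {H 𝓕 : Set (Finset ℕ+)} {P : Set ℕ+}
    (h : Captured H 𝓕 P) (hP : P.Infinite) (p₀ : ℕ) :
    ∃ P' ⊆ P, P'.Infinite ∧ ∀ p ≤ p₀, CapturedAfter H 𝓕 p P' := by
  obtain ⟨e, he, heP⟩ := exists_strictMono_mem hP
  refine ⟨after P {e p₀.succPNat}, after_subset _ _, after_infinite hP _,
    fun p hp m hm hmP F hF hpF => ?_⟩
  have hlt : ∀ i j : ℕ+, (i : ℕ) ≤ p → p < (j : ℕ) → e i < m j := fun i j hi hj => by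
    refine lt_of_le_of_lt (he.monotone ?_) ((hmP j hj).2 _ (Finset.mem_singleton_self _))
    show (i : ℕ) ≤ p₀ + 1
    omega
  have := h (fun j => if (j : ℕ) ≤ p then e j else m j) (fun i j hij => ?_) (fun j => ?_) F hF
  · convert this using 1
    refine Finset.image_congr fun j hj => ?_
    simp [not_le.2 (hpF j hj)]
  · have hij' : (i : ℕ) < j := hij
    dsimp only
    split_ifs with hi hj hj
    · exact he hij
    · exact hlt i j hi (not_le.1 hj)
    · omega
    · exact hm hij
  · split_ifs with hj
    · exact heP j
    · exact (hmP j (not_le.1 hj)).1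

/-- Diagonalization for captured families.  The positions up to `p ≤ max s` may be ignored; they
include the positions of the elements of `s`, an element being at least its position. -/
lemma exists_capturedAfter_diagonal {M : Set ℕ+} (hM : M.Infinite)
    {H 𝓕 : Finset ℕ+ → Set (Finset ℕ+)} (h : ∀ s, DenseBelow M (Captured (H s) (𝓕 s))) :
    ∃ N ⊆ M, N.Infinite ∧ ∀ s : Finset ℕ+, (s : Set ℕ+) ⊆ N →
      ∀ p ≤ s.sup PNat.val, CapturedAfter (H s) (𝓕 s) p (after N s) := by
  refine exists_diagonal hM
    (Q := fun s P => ∀ p ≤ s.sup PNat.val, CapturedAfter (H s) (𝓕 s) p P)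
    (fun s P P' hP hQ p hp => capturedAfter_hereditary _ _ p P P' hP (hQ p hp))
    fun s P hP hi => ?_
  obtain ⟨P₁, h₁, hi₁, hc⟩ := h s P hP hi
  obtain ⟨P₂, h₂, hi₂, hc₂⟩ := hc.exists_capturedAfter hi₁ (s.sup PNat.val)
  exact ⟨P₂, h₂.trans h₁, hi₂, hc₂⟩

/-- Diagonalization over countably many families: the `k`-th one is captured beyond `k`. -/
lemma exists_captured_diagonal {M : Set ℕ+} (hM : M.Infinite) {H : ℕ → Set (Finset ℕ+)}
    {𝓕 : Set (Finset ℕ+)} (h : ∀ k, DenseBelow M (Captured (H k) 𝓕)) :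
    ∃ N ⊆ M, N.Infinite ∧ Captured {F | ∃ k, F ∈ H k ∧ ∀ j ∈ F, k < (j : ℕ)} 𝓕 N := by
  obtain ⟨N, hNM, hN, hc⟩ := exists_capturedAfter_diagonal hM
    (H := fun s => {F | ∃ k ≤ s.sup PNat.val, F ∈ H k}) (𝓕 := fun _ => 𝓕) fun s P hP hi => by
      obtain ⟨P', hP', hi', hc⟩ := DenseBelow.forall_finset
        (fun k => captured_hereditary (H k) 𝓕) h (Finset.range (s.sup PNat.val + 1)) P hP hi
      exact ⟨P', hP', hi', fun m hm hmP F ⟨k, hk, hF⟩ =>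
        hc k (Finset.mem_range.2 (Nat.lt_succ_of_le hk)) m hm hmP F hF⟩
  refine ⟨N, hNM, hN, fun m hm hmN F ⟨k, hF, hkF⟩ => ?_⟩
  set s : Finset ℕ+ := (Finset.range k).image fun i => m i.succPNat with hs
  have hk : k ≤ s.sup PNat.val := by
    cases k with
    | zero => exact Nat.zero_le _
    | succ k =>
      refine (hm.nat_le_apply k.succPNat).trans (Finset.le_sup (f := PNat.val) ?_)
      exact Finset.mem_image.2 ⟨k, Finset.self_mem_range_succ k, rfl⟩
  refine hc s (fun q hq => ?_) k hk m hm (fun j hj => ⟨hmN j, fun q hq => ?_⟩) F ⟨k, hk, hF⟩ hkF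
  · obtain ⟨i, _, rfl⟩ := Finset.mem_image.1 hq
    exact hmN _
  · obtain ⟨i, hi, rfl⟩ := Finset.mem_image.1 hq
    refine hm ?_
    show i + 1 < j + 0
    have := Finset.mem_range.1 hi
    omega

/-- For spreading families, capturing the members beyond `n` is enough. -/
lemma Captured.of_beyond {S 𝓕 : Set (Finset ℕ+)} (hS : SpreadClosed S) {n : ℕ+} {P : Set ℕ+}
    (hP : P.Infinite) (h : Captured {F | F ∈ S ∧ ∀ j ∈ F, n < j} 𝓕 P) :
    ∃ N ⊆ P, N.Infinite ∧ Captured S 𝓕 N := by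
  obtain ⟨P', hP', hi', hc⟩ := h.exists_capturedAfter hP n
  refine ⟨after P' {n}, (after_subset _ _).trans hP', after_infinite hi' _,
    fun m hm hmP F hF => ?_⟩
  have hsub : ∀ j : ℕ+, j + n - n = j := fun j => PNat.add_sub
  have hnm : ∀ j, n < m j := fun j => (hmP j).2 n (Finset.mem_singleton_self n)
  have hbig : ∀ j ∈ F.image (· + n), n < j := fun j hj => by
    obtain ⟨i, _, rfl⟩ := Finset.mem_image.1 hj
    exact PNat.lt_add_left n i
  have := hc n le_rfl (fun j => if j ≤ n then j else m (j - n)) (fun i j hij => ?_)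
    (fun j hj => ?_) (F.image (· + n)) ⟨?_, hbig⟩ hbig
  · convert this using 1
    rw [Finset.image_image]
    refine Finset.image_congr fun j _ => ?_
    simp only [Function.comp]
    rw [if_neg (not_le.2 (PNat.lt_add_left n j)), hsub]
  · dsimp only
    split_ifs with h1 h2 h2
    · exact hij
    · exact h1.trans_lt (hnm _)
    · exact absurd (hij.le.trans h2) h1
    · refine hm ?_
      rw [← PNat.coe_lt_coe, PNat.sub_coe, PNat.sub_coe, if_pos (not_le.1 h1),
        if_pos (not_le.1 h2)]
      have h3 : (n : ℕ) < i := not_le.1 h1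
      have h4 : (i : ℕ) < j := hij
      omega
  · rw [if_neg (not_le.2 (show n < j from hj))]
    exact (hmP _).1
  · refine hS (ψ := fun j => j - n) hF (fun i hi j hj hij => ?_) (fun j hj => ?_) fun j hj => ?_
    · obtain ⟨i, _, rfl⟩ := Finset.mem_image.1 hi
      obtain ⟨j, _, rfl⟩ := Finset.mem_image.1 hj
      dsimp only at hij ⊢
      rw [hsub, hsub]
      exact lt_of_add_lt_add_right hij
    · obtain ⟨j, hj, rfl⟩ := Finset.mem_image.1 hj
      rwa [hsub]
    · obtain ⟨j, hj, rfl⟩ := Finset.mem_image.1 hj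
      rw [hsub]
      exact (PNat.lt_add_right j n).le

/-- Some member of `𝓕` has mass at least `ε` for each of the first `k` averages of `L`. -/
def Charges (f : Set ℕ+ → (ℕ+ →₀ ℝ)) (ε : ℝ) (k : ℕ) (𝓕 : Set (Finset ℕ+)) (L : Set ℕ+) : Prop :=
  ∃ F ∈ 𝓕, ∀ i < k, ε ≤ ∑ j ∈ F, iterateFirst f L i j

/-- `𝓕` is large on `N`: it charges the first `k` averages of every infinite `L ⊆ N`. -/
def Large (f : Set ℕ+ → (ℕ+ →₀ ℝ)) (ε : ℝ) (k : ℕ) (𝓕 : Set (Finset ℕ+)) (N : Set ℕ+) : Prop :=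
  ∀ L ⊆ N, L.Infinite → Charges f ε k 𝓕 L

lemma large_hereditary (f : Set ℕ+ → (ℕ+ →₀ ℝ)) (ε : ℝ) (k : ℕ) (𝓕 : Set (Finset ℕ+)) :
    Hereditary (Large f ε k 𝓕) := fun _ _ h hP L hL => hP L (hL.trans h)

section Large

variable {f : Set ℕ+ → (ℕ+ →₀ ℝ)}

lemma IsInitialAverage.large_or (hf : IsInitialAverage f) (ε : ℝ) (k : ℕ)
    (𝓕 : Set (Finset ℕ+)) {P : Set ℕ+} (hP : P.Infinite) :
    ∃ N ⊆ P, N.Infinite ∧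
      (Large f ε k 𝓕 N ∨ ∀ L ⊆ N, L.Infinite → ¬ Charges f ε k 𝓕 L) := by
  refine exists_homogeneous (Charges f ε k 𝓕) (fun L hL ⟨F, hF, h⟩ => ?_) hP
  obtain ⟨n, hn⟩ := hf.exists_agreeUpTo hL k
  exact ⟨n, fun L' hL' hag => ⟨F, hF, fun i hi => by rw [hn L' hL' hag i hi]; exact h i hi⟩⟩

/-- Every family of finite sets, closed under subsets, which is large for the averages `f`,
captures `S`. -/
def LargeCaptures (f : Set ℕ+ → (ℕ+ →₀ ℝ)) (S : Set (Finset ℕ+)) : Prop :=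
  ∀ 𝓕 : Set (Finset ℕ+), IsLowerSet 𝓕 → ∀ ε > 0, ∀ M : Set ℕ+, M.Infinite → Large f ε 1 𝓕 M →
    ∃ N ⊆ M, N.Infinite ∧ Captured S 𝓕 N

/-- Largeness for `k` successive averages captures the unions of `k` blocks.  The first block is
captured by the family `𝓖` of those sets `s` for which `{G | s ∪ G ∈ 𝓕}` is large for the
remaining averages. -/
theorem LargeCaptures.captured_blocks {S : Set (Finset ℕ+)} (hf : IsInitialAverage f)
    (hc : LargeCaptures f S) {ε : ℝ} (hε : 0 < ε) (k : ℕ) :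
    ∀ 𝓕 : Set (Finset ℕ+), IsLowerSet 𝓕 → ∀ M : Set ℕ+, M.Infinite → Large f ε k 𝓕 M →
      ∃ N ⊆ M, N.Infinite ∧ Captured (blocks S k) 𝓕 N := by
  classical
  induction k with
  | zero =>
    intro 𝓕 h𝓕 M hM hL
    refine ⟨M, subset_rfl, hM, fun m _ _ F hF => ?_⟩
    obtain rfl : F = ∅ := hF
    obtain ⟨F, hF, -⟩ := hL M subset_rfl hM
    exact h𝓕 (by simp) hF
  | succ k ih =>
    intro 𝓕 h𝓕 M hM hL
    let link : Finset ℕ+ → Set (Finset ℕ+) := fun s => {G | s ∪ G ∈ 𝓕}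
    have hlink : ∀ s, IsLowerSet (link s) := fun s G G' h hG =>
      h𝓕 (Finset.union_subset_union_right h) hG
    obtain ⟨N₁, hN₁M, hN₁, hdec⟩ := exists_diagonal hM
      (Q := fun s P => Large f ε k (link s) P ∨ ∀ L ⊆ P, L.Infinite → ¬ Charges f ε k (link s) L)
      (fun s P P' h => Or.imp (large_hereditary _ _ _ _ P P' h) fun hP L hL => hP L (hL.trans h))
      (fun s P _ hi => hf.large_or ε k (link s) hi)
    let 𝓖 : Set (Finset ℕ+) := {s | ↑s ⊆ N₁ ∧ Large f ε k (link s) (after N₁ s)}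
    have h𝓖 : IsLowerSet 𝓖 := by
      rintro s t hts ⟨hs, hsL⟩
      have ht : ↑t ⊆ N₁ := fun q hq => hs (hts hq)
      refine ⟨ht, (hdec t ht).resolve_right fun hno => ?_⟩
      obtain ⟨F, hF, h⟩ := hsL _ subset_rfl (after_infinite hN₁ s)
      exact hno _ (fun q hq => ⟨hq.1, fun r hr => hq.2 r (hts hr)⟩) (after_infinite hN₁ s)
        ⟨F, h𝓕 (Finset.union_subset_union_left hts) hF, h⟩
    have hlarge : Large f ε 1 𝓖 N₁ := by
      intro L hLN hLi
      obtain ⟨F, hF, h⟩ := hL L (hLN.trans hN₁M) hLi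
      set t := F ∩ (f L).support with ht
      have htN : ↑t ⊆ N₁ := fun q hq =>
        hLN (hf.subset hLi (Finset.mem_of_mem_inter_right hq))
      refine ⟨t, ⟨htN, (hdec t htN).resolve_right fun hno => ?_⟩, fun i hi => ?_⟩
      · refine hno (after L (f L).support)
          (fun q hq => ⟨hLN hq.1, fun r hr => hq.2 r (Finset.mem_of_mem_inter_right hr)⟩)
          (after_infinite hLi _) ⟨F, ?_, fun i hi => ?_⟩
        · show t ∪ F ∈ 𝓕
          rwa [Finset.union_eq_right.2 Finset.inter_subset_left]
        · rw [← hf.iterateFirst_add_one hLi]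
          exact h (i + 1) (Nat.succ_lt_succ hi)
      · obtain rfl : i = 0 := by omega
        refine (h 0 k.succ_pos).trans (le_of_eq ?_)
        refine (Finset.sum_subset Finset.inter_subset_left fun q hq hqt => ?_).symm
        by_contra hne
        exact hqt (Finset.mem_inter.2 ⟨hq, Finsupp.mem_support_iff.2 hne⟩)
    obtain ⟨N₂, hN₂, hN₂i, hcap⟩ := hc 𝓖 h𝓖 ε hε N₁ hN₁ hlarge
    obtain ⟨N, hN, hNi, hdiag⟩ := exists_capturedAfter_diagonal hN₂i
      (H := fun _ => blocks S k) (𝓕 := fun s => {F | s ∈ 𝓖 → F ∈ link s}) fun s P hP hi => by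
        by_cases hs : s ∈ 𝓖
        · obtain ⟨P', hP', hi', h⟩ := ih (link s) (hlink s) (after P s) (after_infinite hi s)
            (large_hereditary _ _ _ _ _ _ (after_mono (hP.trans hN₂) s) hs.2)
          exact ⟨P', hP'.trans (after_subset _ _), hi', fun m hm hmP F hF _ => h m hm hmP F hF⟩
        · exact ⟨P, subset_rfl, hi, fun _ _ _ _ _ h => (hs h).elim⟩
    refine ⟨N, (hN.trans hN₂).trans hN₁M, hNi, ?_⟩
    rintro m hm hmN _ ⟨G, hG, K, hK, hlt, rfl⟩
    rw [Finset.image_union]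
    refine hdiag (G.image m) (fun q hq => ?_) (G.sup PNat.val) (Finset.sup_le fun j hj => ?_) m hm
      (fun j hj => ⟨hmN j, fun q hq => ?_⟩) K hK (fun j hj => ?_)
      (hcap m hm (fun j => hN (hmN j)) G hG)
    · obtain ⟨i, _, rfl⟩ := Finset.mem_image.1 hq
      exact hmN i
    · exact (hm.nat_le_apply j).trans
        (Finset.le_sup (f := PNat.val) (Finset.mem_image_of_mem m hj))
    · obtain ⟨i, hi, rfl⟩ := Finset.mem_image.1 hq
      exact hm (PNat.coe_lt_coe _ _ |>.1 (lt_of_le_of_lt (Finset.le_sup (f := PNat.val) hi) hj))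
    · exact (Finset.sup_lt_iff j.pos).2 fun i hi => hlt i hi j hj

/-- A set of mass at least `ε` for `averageSucc f L` has mass at least `ε / 2` for many of the
averages of `L`. -/
lemma IsInitialAverage.card_le (hf : IsInitialAverage f) {L : Set ℕ+} (hL : L.Infinite) {ε : ℝ}
    {F : Finset ℕ+} (hF : ε ≤ ∑ j ∈ F, averageSucc f L j) (hε : 0 ≤ ε) :
    (minElt L : ℕ) * (ε / 2) ≤ ((Finset.range (minElt L : ℕ)).filter
      fun i => ε / 2 ≤ ∑ j ∈ F, iterateFirst f L i j).card := by
  classical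
  set l : ℕ := (minElt L : ℕ)
  have hl : (0 : ℝ) < l := Nat.cast_pos.2 (minElt L).pos
  set I := (Finset.range l).filter fun i => ε / 2 ≤ ∑ j ∈ F, iterateFirst f L i j with hI
  rw [sum_averageSucc] at hF
  have h1 : (l : ℝ) * ε ≤ ∑ i ∈ Finset.range l, ∑ j ∈ F, iterateFirst f L i j := by
    rwa [← div_eq_inv_mul, le_div_iff₀ hl, mul_comm] at hF
  have h2 : ∑ i ∈ Finset.range l, ∑ j ∈ F, iterateFirst f L i j ≤
      ∑ i ∈ Finset.range l, ((if i ∈ I then 1 else 0) + ε / 2) := by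
    refine Finset.sum_le_sum fun i hi => ?_
    split_ifs with h
    · have := hf.iterateFirst_sum_le_one hL i F
      linarith
    · rw [hI, Finset.mem_filter, not_and] at h
      have := not_le.1 (h hi)
      linarith
  have h3 : ∑ i ∈ Finset.range l, (if i ∈ I then (1 : ℝ) else 0) = I.card := by
    rw [Finset.sum_ite_mem, Finset.inter_eq_right.2 (hI ▸ Finset.filter_subset _ _)]
    simp
  rw [Finset.sum_add_distrib, h3] at h2
  simp only [Finset.sum_const, Finset.card_range, _root_.nsmul_eq_mul] at h2
  linarith

/-- The first `k` terms of some strictly increasing sequence lie in a set with `k` elements. -/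
lemma exists_strictMono_extend {I : Finset ℕ} {k : ℕ} (h : k ≤ I.card) :
    ∃ i : ℕ → ℕ, StrictMono i ∧ ∀ j < k, i j ∈ I := by
  let e := I.orderEmbOfCardLe h
  refine ⟨fun j => if hj : j < k then e ⟨j, hj⟩ else I.sup id + 1 + j, fun a b hab => ?_,
    fun j hj => ?_⟩
  · dsimp only
    split_ifs with ha hb hb
    · exact e.strictMono hab
    · have := Finset.le_sup (f := id) (I.orderEmbOfCardLe_mem h ⟨a, ha⟩)
      simp only [id] at this
      show I.orderEmbOfCardLe h ⟨a, ha⟩ < _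
      omega
    · omega
    · omega
  · dsimp only
    rw [dif_pos hj]
    exact I.orderEmbOfCardLe_mem h _

theorem LargeCaptures.succ {S : Set (Finset ℕ+)} (h0 : ∅ ∈ S) (hf : IsInitialAverage f)
    (hc : LargeCaptures f S) : LargeCaptures (averageSucc f) (schreierSucc S) := by
  intro 𝓕 h𝓕 ε hε M hM hL
  obtain ⟨N, hN, hNi, hcap⟩ := exists_captured_diagonal hM
    (H := fun k => blocks S (k + 1)) (𝓕 := 𝓕) fun k P hP hi => by
      obtain ⟨N, hNP, hN, h | h⟩ := hf.large_or (ε / 2) (k + 1) 𝓕 hi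
      · obtain ⟨N', hN', hi', h'⟩ := hc.captured_blocks hf (half_pos hε) (k + 1) 𝓕 h𝓕 N hN h
        exact ⟨N', hN'.trans hNP, hi', h'⟩
      · exfalso
        -- For `min L` this large, at least `min L * (ε / 2) > k` of the averages are charged; the
        -- subset `L'` on which they become the first ones contradicts `h`.
        obtain ⟨q, hq⟩ := exists_nat_gt ((k + 1 : ℕ) / (ε / 2))
        set L := after N {q.succPNat} with hLdef
        have hLi : L.Infinite := after_infinite hN _
        have hmin : q ≤ (minElt L : ℕ) := by
          have : q + 1 < (minElt L : ℕ) :=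
            (minElt_mem hLi.nonempty).2 _ (Finset.mem_singleton_self _)
          omega
        obtain ⟨F, hF, hFε⟩ := hL L (((after_subset _ _).trans hNP).trans hP) hLi
        have hcard := hf.card_le hLi (hFε 0 one_pos) hε.le
        obtain ⟨i, hi, hiI⟩ := exists_strictMono_extend (k := k + 1)
          (I := (Finset.range (minElt L : ℕ)).filter
            fun i => ε / 2 ≤ ∑ j ∈ F, iterateFirst f L i j) (by
            rw [div_lt_iff₀ (half_pos hε)] at hq
            have : (q : ℝ) * (ε / 2) ≤ (minElt L : ℕ) * (ε / 2) :=
              mul_le_mul_of_nonneg_right (Nat.cast_le.2 hmin) (half_pos hε).le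
            exact_mod_cast (hq.trans_le (this.trans hcard)).le)
        obtain ⟨L', hL'L, hL'i, hL'⟩ := hf.exists_subsequence hLi hi
        refine h L' (hL'L.trans (after_subset _ _)) hL'i ⟨F, hF, fun j hj => ?_⟩
        rw [hL']
        exact (Finset.mem_filter.1 (hiI j hj)).2
  refine ⟨N, hN, hNi, fun m hm hmN F hF => hcap m hm hmN F ?_⟩
  obtain ⟨n, hn, hF⟩ := (mem_schreierSucc_iff h0).1 hF
  refine ⟨n.natPred, by rwa [PNat.natPred_add_one], fun j hj => ?_⟩
  have h1 : (n : ℕ) ≤ j := hn j hj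
  have h2 := n.natPred_add_one
  omega

end Large

/-- If `{m} ∪ L` is charged for all `L ⊆ P` by the averages of order `ζ + 1`, where `m` is large,
then all but the first of the `m` averages of order `ζ` involved live on `L`. -/
lemma exists_large_of_large_succ {f : Set ℕ+ → (ℕ+ →₀ ℝ)} (hf : IsInitialAverage f) {ε : ℝ}
    (hε : 0 < ε) {𝓕 : Set (Finset ℕ+)} {m : ℕ+} (hm : 2 / ε < m) {P : Set ℕ+}
    (hP : P.Infinite) (hmP : ∀ q ∈ P, m < q)
    (h : ∀ L ⊆ P, L.Infinite → ∃ F ∈ 𝓕, ε ≤ ∑ j ∈ F, averageSucc f (insert m L) j) :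
    ∃ N ⊆ P, N.Infinite ∧ Large f (ε / 2) 1 𝓕 N := by
  classical
  obtain ⟨N, hNP, hN, hl | hno⟩ := hf.large_or (ε / 2) 1 𝓕 hP
  · exact ⟨N, hNP, hN, hl⟩
  exfalso
  obtain ⟨F, hF, hFε⟩ := h N hNP hN
  set L := insert m N with hLdef
  have hLi : L.Infinite := hN.mono (Set.subset_insert m N)
  have hmin : minElt L = m := minElt_eq (Set.mem_insert m N) fun q hq => by
    rcases hq with rfl | hq
    · exact le_rfl
    · exact (hmP q (hNP hq)).le
  have hcard := hf.card_le hLi hFε hε.le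
  rw [hmin] at hcard
  have hsub : ((Finset.range (m : ℕ)).filter
      fun i => ε / 2 ≤ ∑ j ∈ F, iterateFirst f L i j) ⊆ {0} := by
    intro i hi
    rw [Finset.mem_singleton]
    by_contra hi0
    have hrest : rest f L i ⊆ N := by
      intro q hq
      have h1 := hf.rest_antitone hLi (Nat.one_le_iff_ne_zero.2 hi0) hq
      refine h1.1.resolve_left fun hqm => ?_
      have := h1.2 m (hmin ▸ hf.minElt_mem_support hLi)
      exact this.ne hqm.symm
    refine hno _ hrest (IsInitialAverage.rest_infinite hLi i) ⟨F, hF, fun j hj => ?_⟩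
    obtain rfl : j = 0 := by omega
    have := (Finset.mem_filter.1 hi).2
    rwa [iterateFirst_eq] at this
  have h1 := Finset.card_le_card hsub
  rw [Finset.card_singleton] at h1
  have h2 : (m : ℕ) * (ε / 2) ≤ (1 : ℝ) := hcard.trans (by exact_mod_cast h1)
  rw [div_lt_iff₀ hε] at hm
  linarith

theorem largeCaptures_zero : LargeCaptures (firstAverage A 0) (schreier A 0) := by
  intro 𝓕 h𝓕 ε hε M hM hL
  refine ⟨M, subset_rfl, hM, fun m _ hmM F hF => ?_⟩
  rcases (mem_schreier_zero A).1 hF with rfl | ⟨n, rfl⟩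
  · obtain ⟨F, hF, -⟩ := hL M subset_rfl hM
    exact h𝓕 (by simp) hF
  · have hinf := after_infinite hM {m n}
    obtain ⟨F, hF, h⟩ := hL (insert (m n) (after M {m n}))
      (Set.insert_subset (hmM n) (after_subset _ _)) (hinf.mono (Set.subset_insert _ _))
    have h := h 0 one_pos
    have hmin : minElt (insert (m n) (after M {m n})) = m n :=
      minElt_eq (Set.mem_insert _ _) fun q hq => by
        rcases hq with rfl | hq
        · exact le_rfl
        · exact (hq.2 _ (Finset.mem_singleton_self _)).le
    rw [firstAverage_zero, iterateFirst, hmin] at h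
    refine h𝓕 ?_ hF
    rw [Finset.image_singleton, Finset.singleton_subset_iff]
    by_contra hn
    rw [Finset.sum_eq_zero fun j hj => ?_] at h
    · linarith
    · exact Finsupp.single_eq_of_ne fun hjn => hn (hjn ▸ hj)

theorem largeCaptures_limit {ξ : Ordinal.{0}} (hξ : ξ < ω₁) (h : Order.IsSuccLimit ξ)
    (ih : ∀ ζ < ξ, LargeCaptures (firstAverage A ζ) (schreier A ζ)) :
    LargeCaptures (firstAverage A ξ) (schreier A ξ) := by
  intro 𝓕 h𝓕 ε hε M hM hL
  obtain ⟨N, hN, hNi, hcap⟩ := exists_captured_diagonal hM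
    (H := fun k => schreier A (A.seq ξ k.succPNat + 1)) (𝓕 := 𝓕) fun k P hP hi => by
      set η := A.seq ξ k.succPNat + 1 with hη
      -- For `m > 2 / ε` in `P` and beyond `k + 1`, largeness for `ξ` on the sets with least
      -- element `m` is largeness for `ξₘ + 1`, hence for `ξₘ ≥ η` on a smaller set.
      obtain ⟨q, hq⟩ := exists_nat_gt (2 / ε)
      obtain ⟨m, hmP, hm⟩ := hi.exists_gt (max k q).succPNat
      have hm' : max k q + 1 < (m : ℕ) := hm
      have hkm : k.succPNat < m := show k + 1 < (m : ℕ) by omega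
      set ζ := A.seq ξ m with hζ
      have hζξ : ζ < ξ := (lt_add_one ζ).trans (A.lt hξ h m)
      have hηζ : η ≤ ζ := Order.lt_add_one_iff.1 (A.strictMono ξ hξ h hkm)
      obtain ⟨N, hNP, hN, hl⟩ := exists_large_of_large_succ
        (isInitialAverage_firstAverage A ζ (hζξ.trans hξ)) hε (𝓕 := 𝓕) (m := m)
        (hq.trans (by exact_mod_cast (show q < (m : ℕ) by omega)))
        (after_infinite hi {m}) (fun r hr => hr.2 m (Finset.mem_singleton_self m))
        fun L hLP hLi => by
          obtain ⟨F, hF, hFε⟩ := hL (insert m L)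
            (Set.insert_subset (hP hmP) ((hLP.trans (after_subset _ _)).trans hP))
            (hLi.mono (Set.subset_insert m L))
          have hmin : minElt (insert m L) = m := minElt_eq (Set.mem_insert m L) fun r hr => by
            rcases hr with rfl | hr
            · exact le_rfl
            · exact ((hLP hr).2 m (Finset.mem_singleton_self m)).le
          refine ⟨F, hF, ?_⟩
          have := hFε 0 one_pos
          rwa [iterateFirst, firstAverage_limit A hξ h, hmin, firstAverage_add_one] at this
      obtain ⟨N', hN'N, hN', hc⟩ := ih ζ hζξ 𝓕 h𝓕 (ε / 2) (half_pos hε) N hN hl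
      obtain ⟨n, hn⟩ := exists_schreier_subset A ζ (hζξ.trans hξ) η hηζ
      obtain ⟨N'', hN'', hi'', hc''⟩ := Captured.of_beyond
        (spreadClosed_schreier A η ((hηζ.trans_lt hζξ).trans hξ)) (n := n) (𝓕 := 𝓕) hN'
        fun g hg hgN F ⟨hF, hFn⟩ => hc g hg hgN F (hn F hF fun p hp => (hFn p hp).le)
      exact ⟨N'', ((hN''.trans hN'N).trans hNP).trans (after_subset _ _), hi'', hc''⟩
  refine ⟨N, hN, hNi, fun m hm hmN F hF => hcap m hm hmN F ?_⟩
  obtain ⟨n, hn, hF⟩ := (mem_schreier_limit A hξ h).1 hF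
  refine ⟨n.natPred, by rwa [PNat.succPNat_natPred], fun j hj => ?_⟩
  have h1 : (n : ℕ) ≤ j := hn j hj
  have h2 := n.natPred_add_one
  omega

/-- The combinatorial core: a family of finite sets closed under subsets which has mass at least
`ε` for the first average of order `ξ` of every infinite subset of `M` contains a transport of the
Schreier family of order `ξ`. -/
theorem largeCaptures (ξ : Ordinal.{0}) (hξ : ξ < ω₁) :
    LargeCaptures (firstAverage A ξ) (schreier A ξ) := by
  refine countable_induction
    (p := fun ξ => LargeCaptures (firstAverage A ξ) (schreier A ξ)) (largeCaptures_zero A)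
    (fun ζ hζ ih => ?_) (fun ξ hξ h ih => largeCaptures_limit A hξ h ih) ξ hξ
  have hζ' := (lt_add_one ζ).trans hζ
  rw [firstAverage_add_one, schreier_add_one]
  exact ih.succ (empty_mem_schreier A ζ hζ') (isInitialAverage_firstAverage A ζ hζ')

/-! ### Functionals on weakly null sequences -/

variable {X : Type*} [NormedAddCommGroup X] [NormedSpace ℝ X]

/-- Some functional in the dual unit ball is at least `δ` on the vectors indexed by `P` and at most
`η` in absolute value on those indexed by `B`. -/
def Separates (x : ℕ+ → X) (δ η : ℝ) (P B : Finset ℕ+) : Prop :=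
  ∃ f : X →L[ℝ] ℝ, ‖f‖ ≤ 1 ∧ (∀ n ∈ P, δ ≤ f (x n)) ∧ ∀ n ∈ B, |f (x n)| ≤ η

lemma Separates.mono {x : ℕ+ → X} {δ η : ℝ} {P P' B B' : Finset ℕ+} (h : Separates x δ η P B)
    (hP : P' ⊆ P) (hB : B' ⊆ B) : Separates x δ η P' B' := by
  obtain ⟨f, hf, h1, h2⟩ := h
  exact ⟨f, hf, fun n hn => h1 n (hP hn), fun n hn => h2 n (hB hn)⟩

lemma WeaklyNull.exists_norm_le {x : ℕ+ → X} (hx : WeaklyNull x) :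
    ∃ K : ℝ, 0 < K ∧ ∀ n, ‖x n‖ ≤ K := by
  obtain ⟨K, hK⟩ := banach_steinhaus (g := fun n => NormedSpace.inclusionInDoubleDual ℝ X (x n))
    fun f => by
      have h1 : Tendsto (fun n : ℕ => f (x n.succPNat)) atTop (𝓝 0) :=
        (hx f).comp (tendsto_atTop_atTop.2 fun b => ⟨b, fun a ha => by
          show (b : ℕ) ≤ a + 1
          omega⟩)
      obtain ⟨C, hC⟩ := (Metric.isBounded_range_of_tendsto _ h1).exists_norm_le
      refine ⟨C, fun n => ?_⟩
      simpa using hC _ ⟨n.natPred, rfl⟩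
  refine ⟨max K 1, lt_max_of_lt_right one_pos, fun n => le_max_of_le_left ?_⟩
  have := hK n
  rwa [show ‖NormedSpace.inclusionInDoubleDual ℝ X (x n)‖ = ‖x n‖ from
    (NormedSpace.inclusionInDoubleDualLi ℝ).norm_map (x n)] at this

/-- By weak-star compactness of the dual ball, a weakly null sequence has no infinite subset every
finite part of which is bounded away from zero by one functional in the dual ball. -/
lemma WeaklyNull.exists_finset {x : ℕ+ → X} (hx : WeaklyNull x) {η : ℝ} (hη : 0 < η)
    {N : Set ℕ+} (hN : N.Infinite) :
    ∃ s : Finset ℕ+, ↑s ⊆ N ∧ ∀ f : X →L[ℝ] ℝ, ‖f‖ ≤ 1 → ∃ l ∈ s, |f (x l)| < η := by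
  classical
  by_contra hno
  push Not at hno
  obtain ⟨f, hf, hfN⟩ := (WeakDual.isCompact_closedBall (𝕜 := ℝ) (E := X) 0 1).inter_iInter_nonempty
    (fun l : N => {f : WeakDual ℝ X | η ≤ |f (x l)|})
    (fun l => isClosed_le continuous_const (WeakDual.eval_continuous (x l)).abs)
    fun u => by
      obtain ⟨f, hf, h⟩ := hno (u.image Subtype.val) (by
        intro l hl
        obtain ⟨l, _, rfl⟩ := Finset.mem_image.1 hl
        exact l.2)
      refine ⟨StrongDual.toWeakDual f, ?_, Set.mem_iInter₂.2 fun l hl => ?_⟩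
      · simpa using hf
      · exact h l (Finset.mem_image_of_mem _ hl)
  have h1 : ∀ᶠ n in atTop, |f (x n)| < η := by
    have := (hx (WeakDual.toStrongDual f)).abs
    rw [abs_zero] at this
    exact this.eventually_lt_const hη
  obtain ⟨a, ha⟩ := eventually_atTop.1 h1
  obtain ⟨b, hb, hab⟩ := hN.exists_gt a
  exact absurd (ha b hab.le) (not_lt.2 (Set.mem_iInter.1 hfN ⟨b, hb⟩))

lemma separates_insert_hereditary (x : ℕ+ → X) (δ η : ℝ) (A B : Finset ℕ+) :
    Hereditary fun P => ∀ l ∈ P, ∀ G : Finset ℕ+, ↑G ⊆ P → (∀ g ∈ G, l < g) →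
      Separates x δ η (A ∪ G) B → Separates x δ η (A ∪ G) (insert l B) :=
  fun _ _ h hP l hl G hG => hP l (h hl) G (hG.trans h)

/-- The Ramsey step towards unconditionality.  If every infinite `L ⊆ N` had an initial segment
`{l} ∪ G` with `A ∪ G` separated from `B` but not from `B ∪ {l}`, then, comparing finitely many
choices of `l` with the same tail, one functional would be large on all of them. -/
theorem WeaklyNull.denseBelow_separates {x : ℕ+ → X} (hx : WeaklyNull x) (δ : ℝ) {η : ℝ}
    (hη : 0 < η) (A B : Finset ℕ+) (M : Set ℕ+) :
    DenseBelow M fun P => ∀ l ∈ P, ∀ G : Finset ℕ+, ↑G ⊆ P → (∀ g ∈ G, l < g) →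
      Separates x δ η (A ∪ G) B → Separates x δ η (A ∪ G) (insert l B) := by
  classical
  intro P _ hP
  let seg : Set ℕ+ → ℕ+ → Finset ℕ+ := fun L n => (Finset.Ioc (minElt L) n).filter (· ∈ L)
  obtain ⟨N, hNP, hN, hO | hO⟩ := exists_homogeneous
    (fun L => ∃ n, Separates x δ η (A ∪ seg L n) B ∧
      ¬ Separates x δ η (A ∪ seg L n) (insert (minElt L) B))
    (fun L hL ⟨n, hn⟩ => ⟨max n (minElt L), fun L' hL' hag => ⟨n, by
      have hmin := minElt_congr hL hag (le_max_right _ _)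
      have hseg : seg L' n = seg L n := by
        simp only [seg, hmin]
        refine Finset.filter_congr fun k hk => ?_
        exact (hag k ((Finset.mem_Ioc.1 hk).2.trans (le_max_left _ _))).symm
      rw [hmin, hseg]
      exact hn⟩⟩) hP
  · exfalso
    obtain ⟨s, hsN, hs⟩ := hx.exists_finset hη hN
    have hR := after_infinite hN s
    have hmin : ∀ l ∈ s, minElt (insert l (after N s)) = l := fun l hl =>
      minElt_eq (Set.mem_insert _ _) fun q hq => by
        rcases hq with rfl | hq
        · exact le_rfl
        · exact (hq.2 l hl).le
    have key : ∀ l ∈ s, ∃ n : ℕ+,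
        Separates x δ η (A ∪ (Finset.Iic n).filter (· ∈ after N s)) B ∧
        ¬ Separates x δ η (A ∪ (Finset.Iic n).filter (· ∈ after N s)) (insert l B) := by
      intro l hl
      obtain ⟨n, hn⟩ := hO (insert l (after N s))
        (Set.insert_subset (hsN hl) (after_subset _ _)) (hR.mono (Set.subset_insert _ _))
      refine ⟨n, ?_⟩
      have hseg : seg (insert l (after N s)) n = (Finset.Iic n).filter (· ∈ after N s) := by
        ext k
        simp only [seg, hmin l hl, Finset.mem_filter, Finset.mem_Ioc, Finset.mem_Iic,
          Set.mem_insert_iff]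
        constructor
        · rintro ⟨⟨h1, h2⟩, rfl | h3⟩
          · exact absurd h1 (lt_irrefl _)
          · exact ⟨h2, h3⟩
        · rintro ⟨h1, h2⟩
          exact ⟨⟨h2.2 l hl, h1⟩, Or.inr h2⟩
      rwa [hmin l hl, hseg] at hn
    choose! n hn1 hn2 using key
    have hne : s.Nonempty := by
      obtain ⟨l, hl, _⟩ := hs 0 (by simp)
      exact ⟨l, hl⟩
    obtain ⟨l₀, hl₀, hmax⟩ := s.exists_max_image n hne
    obtain ⟨f, hf, hf1, hf2⟩ := hn1 l₀ hl₀
    obtain ⟨l, hl, hfl⟩ := hs f hf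
    refine hn2 l hl ⟨f, hf, fun k hk => hf1 k ?_, fun k hk => ?_⟩
    · refine Finset.union_subset_union_right (Finset.filter_subset_filter _ ?_) hk
      exact Finset.Iic_subset_Iic.2 (hmax l hl)
    · rcases Finset.mem_insert.1 hk with rfl | hk
      · exact hfl.le
      · exact hf2 k hk
  · refine ⟨N, hNP, hN, fun l hl G hG hlG hsep => ?_⟩
    by_contra hno
    set L := insert l (↑G ∪ after N (insert l G)) with hLdef
    have hmin : minElt L = l := minElt_eq (Set.mem_insert _ _) fun q hq => by
      rcases hq with rfl | hq | hq
      · exact le_rfl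
      · exact (hlG q hq).le
      · exact (hq.2 l (Finset.mem_insert_self _ _)).le
    have hne : (insert l G).Nonempty := Finset.insert_nonempty _ _
    have hseg : seg L ((insert l G).max' hne) = G := by
      ext k
      simp only [seg, hmin, Finset.mem_filter, Finset.mem_Ioc]
      constructor
      · rintro ⟨⟨h1, h2⟩, rfl | h3 | h3⟩
        · exact absurd h1 (lt_irrefl _)
        · exact h3
        · exact absurd (h3.2 _ (Finset.max'_mem _ hne)) (not_lt.2 h2)
      · exact fun hk => ⟨⟨hlG k hk, Finset.le_max' _ _ (Finset.mem_insert_of_mem hk)⟩,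
          Or.inr (Or.inl hk)⟩
    refine hO L (Set.insert_subset hl (Set.union_subset hG (after_subset _ _))) ?_
      ⟨(insert l G).max' hne, ?_, ?_⟩
    · exact (after_infinite hN _).mono (Set.subset_union_right.trans (Set.subset_insert _ _))
    · rwa [hseg]
    · rwa [hseg, hmin]

/-- Unconditionality: after passing to a subset `N`, a functional which is large on `F ⊆ E` can be
replaced by one which is moreover small on `E \ F`. -/
theorem WeaklyNull.exists_unconditional {x : ℕ+ → X} (hx : WeaklyNull x) (δ : ℝ) {η : ℝ}
    (hη : 0 < η) {M : Set ℕ+} (hM : M.Infinite) :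
    ∃ N ⊆ M, N.Infinite ∧ ∀ E : Finset ℕ+, ↑E ⊆ N → ∀ F ⊆ E,
      Separates x δ η F ∅ → Separates x δ η F (E \ F) := by
  classical
  obtain ⟨N, hNM, hN, hdiag⟩ := exists_diagonal hM
    (Q := fun s P => ∀ i ∈ s.powerset ×ˢ s.powerset,
      ∀ l ∈ P, ∀ G : Finset ℕ+, ↑G ⊆ P → (∀ g ∈ G, l < g) →
        Separates x δ η (i.1 ∪ G) i.2 → Separates x δ η (i.1 ∪ G) (insert l i.2))
    (fun s P P' h hP i hi => separates_insert_hereditary x δ η i.1 i.2 P P' h (hP i hi))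
    (fun s => DenseBelow.forall_finset
      (fun i : Finset ℕ+ × Finset ℕ+ => separates_insert_hereditary x δ η i.1 i.2)
      (fun i : Finset ℕ+ × Finset ℕ+ => hx.denseBelow_separates δ hη i.1 i.2 M) _)
  refine ⟨N, hNM, hN, ?_⟩
  -- The elements of `E` are treated in increasing order, `G` being the untreated part of `F`.
  have main : ∀ E : Finset ℕ+, ↑E ⊆ N → ∀ G : Finset ℕ+, ↑G ⊆ N → (∀ e ∈ E, ∀ g ∈ G, e < g) →
      ∀ F ⊆ E, Separates x δ η (F ∪ G) ∅ → Separates x δ η (F ∪ G) (E \ F) := by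
    intro E
    induction E using Finset.induction_on_max with
    | empty => intro _ G _ _ F _ h; simpa using h
    | insert l E hlt ih =>
      intro hE G hG hEG F hF h
      have hEN : ↑E ⊆ N := fun k hk => hE (Finset.mem_insert_of_mem hk)
      have hlN : l ∈ N := hE (Finset.mem_insert_self _ _)
      by_cases hl : l ∈ F
      · have hFG : F.erase l ∪ insert l G = F ∪ G := by
          rw [Finset.union_insert, ← Finset.insert_union, Finset.insert_erase hl]
        have := ih hEN (insert l G) (by
          rw [Finset.coe_insert]; exact Set.insert_subset hlN hG) (fun e he g hg => by
            rcases Finset.mem_insert.1 hg with rfl | hg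
            · exact hlt e he
            · exact hEG e (Finset.mem_insert_of_mem he) g hg) (F.erase l)
            (Finset.subset_insert_iff.1 hF) (by rwa [hFG])
        rw [hFG] at this
        refine this.mono subset_rfl fun k hk => ?_
        rw [Finset.mem_sdiff, Finset.mem_insert] at hk
        have hkl : k ≠ l := fun h => hk.2 (h ▸ hl)
        exact Finset.mem_sdiff.2 ⟨hk.1.resolve_left hkl, fun h => hk.2 (Finset.mem_of_mem_erase h)⟩
      · have hFE : F ⊆ E := (Finset.subset_insert_iff_of_notMem hl).1 hF
        have h1 := ih hEN G hG (fun e he => hEG e (Finset.mem_insert_of_mem he)) F hFE h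
        rw [Finset.insert_sdiff_of_notMem _ hl]
        refine hdiag E hEN (F, E \ F) ?_ l ⟨hlN, hlt⟩ G (fun g hg => ⟨hG hg, fun e he =>
          hEG e (Finset.mem_insert_of_mem he) g hg⟩) (hEG l (Finset.mem_insert_self _ _)) h1
        simp [hFE]
  intro E hE F hF h
  simpa using main E hE ∅ (by simp) (by simp) F hF (by simpa using h)

/-! ### The dichotomy -/

lemma act_eq_sum (μ : ℕ+ →₀ ℝ) (x : ℕ+ → X) : act μ x = ∑ k ∈ μ.support, μ k • x k := rfl

/-- If `‖x‖ ≤ K` on `s = supp μ` and the mass of `min s` is at most `1 / min s`, then a lower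
`ℓ₁`-estimate on the rest of `s` gives a lower bound for `‖μ · x‖`. -/
lemma le_norm_act {x : ℕ+ → X} {μ : ℕ+ →₀ ℝ} {q : ℕ+} (hq : q ∈ μ.support) {C K t : ℝ}
    (hsum : ∑ k ∈ μ.support, μ k = 1) (hμ : 0 ≤ μ q) (hμt : μ q ≤ t) (hC : 0 ≤ C)
    (hK : ‖x q‖ ≤ K)
    (h : C * ∑ k ∈ μ.support.erase q, |μ k| ≤ ‖∑ k ∈ μ.support.erase q, μ k • x k‖) :
    C ≤ (C + K) * t + ‖act μ x‖ := by
  have hK0 : 0 ≤ K := (norm_nonneg _).trans hK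
  have h1 : 1 - t ≤ ∑ k ∈ μ.support.erase q, |μ k| := by
    have h2 := Finset.add_sum_erase μ.support (fun k => μ k) hq
    have h3 := Finset.sum_le_sum fun k (_ : k ∈ μ.support.erase q) => le_abs_self (μ k)
    linarith
  have h4 : ‖∑ k ∈ μ.support.erase q, μ k • x k‖ ≤ ‖act μ x‖ + t * K := by
    have h5 := Finset.add_sum_erase μ.support (fun k => μ k • x k) hq
    rw [← act_eq_sum] at h5
    rw [← eq_sub_iff_add_eq'] at h5
    rw [h5]
    refine (norm_sub_le _ _).trans (add_le_add_right ?_ _)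
    rw [norm_smul, Real.norm_of_nonneg hμ]
    exact mul_le_mul hμt hK (norm_nonneg _) (hμ.trans hμt)
  have h6 := mul_le_mul_of_nonneg_left h1 hC
  linarith

/-- For `N ⊆ range m`, there is a sequence `k` such that `m (k j) ∈ N` and the positions `k` grow
faster than the values `m (k j)`. -/
lemma exists_sparse {m : ℕ+ → ℕ+} (hm : StrictMono m) {N : Set ℕ+} (hN : N.Infinite)
    (hNm : N ⊆ Set.range m) :
    ∃ k : ℕ → ℕ+, StrictMono k ∧ (∀ j, m (k j) ∈ N) ∧ ∀ j, m (k j) ≤ k (j + 1) := by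
  have next : ∀ a : ℕ+, ∃ b, m b ∈ N ∧ m a < b := fun a => by
    obtain ⟨_, hc, hac⟩ := hN.exists_gt (m (m a))
    obtain ⟨b, rfl⟩ := hNm hc
    exact ⟨b, hc, hm.lt_iff_lt.1 hac⟩
  choose g hg hlt using next
  let k : ℕ → ℕ+ := fun j => Nat.rec (g 1) (fun _ b => g b) j
  refine ⟨k, strictMono_nat_of_lt_succ fun j => hm.le_apply.trans_lt (hlt (k j)), fun j => ?_,
    fun j => (hlt (k j)).le⟩
  cases j
  · exact hg 1
  · exact hg _

/-- Along a sparse sequence of positions `k`, the positions of the support of an average of order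
`ξ`, without its first point, form a member of the Schreier family: they are a spreading of the
support without its last point. -/
lemma positions_mem_schreier {ξ : Ordinal.{0}} (hξ : ξ < ω₁) {m : ℕ+ → ℕ+} (hm : StrictMono m)
    {k : ℕ → ℕ+} (hk : StrictMono k) (hkm : ∀ j, m (k j) ≤ k (j + 1)) {R : Set ℕ+}
    (hR : R.Infinite) (hRk : R ⊆ Set.range (m ∘ k))
    (hup : ∀ a ∈ R, ∀ j, a ≤ m (k j) → m (k j) ∈ R) :
    ((firstAverage A ξ R).support.erase (minElt R)).preimage m hm.injective.injOn ∈
      schreier A ξ := by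
  classical
  have hf := isInitialAverage_firstAverage A ξ hξ
  set F := ((firstAverage A ξ R).support.erase (minElt R)).preimage m hm.injective.injOn
  have hF : ∀ i ∈ F, ∃ j, i = k (j + 1) ∧ m (k j) ∈ (firstAverage A ξ R).support := by
    intro i hi
    obtain ⟨hne, hs⟩ := Finset.mem_erase.1 (Finset.mem_preimage.1 hi)
    have hiR := hf.subset hR hs
    obtain ⟨j, hj⟩ := hRk hiR
    obtain ⟨j₀, hj₀⟩ := hRk (minElt_mem hR.nonempty)
    have hlt : j₀ < j := by
      refine (hm.comp hk).lt_iff_lt.1 ?_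
      rw [hj, hj₀]
      exact lt_of_le_of_ne (minElt_le hiR) hne.symm
    obtain ⟨j, rfl⟩ : ∃ j', j = j' + 1 := ⟨j - 1, by omega⟩
    refine ⟨j, (hm.injective hj).symm,
      hf.initial hR _ hs _ (hup _ (minElt_mem hR.nonempty) j ?_) ?_⟩
    · rw [← hj₀]
      exact (hm.comp hk).monotone (Nat.lt_succ_iff.1 hlt)
    · rw [← hj]
      exact (hm.comp hk).monotone j.le_succ
  choose! J hJ hJs using hF
  refine spreadClosed_schreier A ξ hξ (ψ := fun i => m (k (J i)))
    (support_firstAverage_mem_schreier A ξ hξ R hR) (fun i hi i' hi' hii => ?_) hJs fun i hi => ?_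
  · rw [hJ i hi, hJ i' hi'] at hii
    exact (hm.comp hk) (Nat.lt_of_succ_lt_succ (hk.lt_iff_lt.1 hii))
  · conv_rhs => rw [hJ i hi]
    exact hkm _

/-- A sequence with an `ℓ₁^ξ` spreading model as a subsequence is not hereditarily convergent
along any subset of that subsequence. -/
theorem not_convergent_of_spreadingModel {x : ℕ+ → X} {ξ : Ordinal.{0}} (h1 : 1 ≤ ξ)
    (hξ : ξ < ω₁) {m : ℕ+ → ℕ+} (hm : StrictMono m)
    (hsp : IsL1SpreadingModel A ξ fun i => x (m i)) {N : Set ℕ+} (hN : N.Infinite)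
    (hNm : N ⊆ Set.range m) :
    ∃ L ⊆ N, L.Infinite ∧ ¬ IsConvergentAlong A ξ L x := by
  classical
  obtain ⟨⟨c, K, _, hcK⟩, C, hC, hsp⟩ := hsp
  obtain ⟨k, hk, hkN, hkm⟩ := exists_sparse hm hN hNm
  have hf := isInitialAverage_firstAverage A ξ hξ
  have hL : (Set.range (m ∘ k)).Infinite :=
    Set.infinite_range_of_injective (hm.comp hk).injective
  refine ⟨Set.range (m ∘ k), by rintro _ ⟨j, rfl⟩; exact hkN j, hL, fun hconv => ?_⟩
  set L := Set.range (m ∘ k)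
  have hK0 : 0 ≤ K := (norm_nonneg _).trans (hcK 1).2
  have key : ∀ r : ℕ, C ≤ (C + K) * (1 / ((r : ℝ) + 1)) + ‖act (average A ξ L r) x‖ := by
    intro r
    rw [average, iterateFirst_eq]
    set R := rest (firstAverage A ξ) L r with hRdef
    have hR : R.Infinite := IsInitialAverage.rest_infinite hL r
    have hRL : R ⊆ L := IsInitialAverage.rest_subset r
    have hup : ∀ a ∈ R, ∀ j, a ≤ m (k j) → m (k j) ∈ R := by
      intro a ha j haj
      cases r with
      | zero => exact ⟨j, rfl⟩
      | succ r => exact ⟨⟨j, rfl⟩, fun b hb => (ha.2 b hb).trans_le haj⟩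
    have hF := positions_mem_schreier A hξ hm hk hkm hR hRL hup
    have hrange : ∀ q ∈ R, q ∈ Set.range m := fun q hq => by
      obtain ⟨j, rfl⟩ := hRL hq
      exact ⟨k j, rfl⟩
    have hlow := hsp _ hF fun i => firstAverage A ξ R (m i)
    have hq := hf.minElt_mem_support hR
    rw [Finset.sum_preimage m _ hm.injective.injOn (fun q => |firstAverage A ξ R q|)
        fun q hq hq' => (hq' (hrange q (hf.subset hR (Finset.mem_of_mem_erase hq)))).elim,
      Finset.sum_preimage m _ hm.injective.injOn (fun q => firstAverage A ξ R q • x q)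
        fun q hq hq' => (hq' (hrange q (hf.subset hR (Finset.mem_of_mem_erase hq)))).elim] at hlow
    refine le_norm_act hq (hf.sum_eq hR _ subset_rfl) (hf.nonneg hR _)
      ((firstAverage_minElt_le A ξ hξ h1 hR).trans ?_) hC.le ?_ hlow
    · rw [one_div]
      have hr := hf.nat_lt_of_mem_rest hL r _ (minElt_mem hR.nonempty)
      refine inv_anti₀ (by positivity) ?_
      exact_mod_cast hr
    · obtain ⟨i, hi⟩ := hrange _ (minElt_mem hR.nonempty)
      rw [← hi]
      exact (hcK i).2
  have hlim : Tendsto (fun r : ℕ => (C + K) * (1 / ((r : ℝ) + 1)) + ‖act (average A ξ L r) x‖)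
      atTop (𝓝 ((C + K) * 0 + 0)) :=
    (tendsto_one_div_add_atTop_nhds_zero_nat.const_mul _).add hconv
  have := ge_of_tendsto' hlim key
  simp only [mul_zero, add_zero] at this
  linarith

/-- If hereditarily convergent subsets are not dense, then on some set all the averages have norm
bounded away from zero. -/
theorem exists_norm_act_gt {x : ℕ+ → X} {ξ : Ordinal.{0}} (hξ : ξ < ω₁) {M : Set ℕ+}
    (hM : M.Infinite)
    (h : ∀ N ⊆ M, N.Infinite → ∃ L ⊆ N, L.Infinite ∧ ¬ IsConvergentAlong A ξ L x) :
    ∃ ε > 0, ∃ N ⊆ M, N.Infinite ∧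
      ∀ L ⊆ N, L.Infinite → ε < ‖act (firstAverage A ξ L) x‖ := by
  have hf := isInitialAverage_firstAverage A ξ hξ
  by_contra hno
  push Not at hno
  -- Otherwise the averages are at most `1 / (n + 1)` on the part of some `N` beyond `n`, for every
  -- `n ∈ N`.
  obtain ⟨N, hNM, hN, hdiag⟩ := exists_diagonal hM
    (Q := fun s P => ∀ L ⊆ P, L.Infinite →
      ‖act (firstAverage A ξ L) x‖ ≤ 1 / ((s.sup PNat.val : ℕ) + 1 : ℝ))
    (fun s P P' h hP L hL => hP L (hL.trans h))
    (fun s P hP hi => by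
      obtain ⟨N, hNP, hN, hO | hO⟩ := exists_homogeneous
        (fun L => 1 / ((s.sup PNat.val : ℕ) + 1 : ℝ) < ‖act (firstAverage A ξ L) x‖)
        (fun L hL hOL => by
          obtain ⟨n, hn⟩ := hf.exists_agreeUpTo hL 1
          refine ⟨n, fun L' hL' hag => ?_⟩
          have h0 : firstAverage A ξ L' = firstAverage A ξ L := hn L' hL' hag 0 one_pos
          rwa [h0]) hi
      · obtain ⟨L, hL, hLi, hle⟩ := hno _ Nat.one_div_pos_of_nat N (hNP.trans hP) hN
        exact absurd (hO L hL hLi) (not_lt.2 hle)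
      · exact ⟨N, hNP, hN, fun L hL hLi => not_lt.1 (hO L hL hLi)⟩)
  obtain ⟨L, hLN, hL, hLc⟩ := h N hNM hN
  refine hLc (Metric.tendsto_atTop.2 fun ε hε => ?_)
  obtain ⟨k, hk⟩ := exists_nat_one_div_lt hε
  obtain ⟨q, hq, hkq⟩ := hL.exists_gt k.succPNat
  refine ⟨q, fun r hr => ?_⟩
  rw [Real.dist_eq, _root_.sub_zero, abs_of_nonneg (norm_nonneg _), average, iterateFirst_eq]
  refine lt_of_le_of_lt (hdiag {q} (by simpa using hLN hq) _ (fun p hp =>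
    ⟨hLN (IsInitialAverage.rest_subset r hp), fun q' hq' => ?_⟩)
    (IsInitialAverage.rest_infinite hL r)) (lt_of_le_of_lt ?_ hk)
  · rw [Finset.mem_singleton.1 hq']
    exact (PNat.coe_lt_coe _ _).1 (lt_of_le_of_lt hr (hf.nat_lt_of_mem_rest hL r p hp))
  · have h1 : k + 1 < (q : ℕ) := hkq
    rw [Finset.sup_singleton]
    refine one_div_le_one_div_of_le (by positivity) ?_
    have : (k : ℝ) ≤ ((q : ℕ) : ℝ) := by exact_mod_cast (by omega : k ≤ (q : ℕ))
    linarith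

/-- If `‖μ · x‖ > ε` for a probability measure `μ`, then a norming functional is at least `ε / 2`
on a set of measure at least `ε / (2 K)`, where `K` bounds `‖x‖`. -/
lemma exists_separates_of_lt_norm_act {x : ℕ+ → X} {K ε η : ℝ} (hK : 0 < K)
    (hxK : ∀ n, ‖x n‖ ≤ K) (hε : 0 < ε) {μ : ℕ+ →₀ ℝ} (hμ : ∀ k, 0 ≤ μ k)
    (hsum : ∑ k ∈ μ.support, μ k = 1) (h : ε < ‖act μ x‖) :
    ∃ F : Finset ℕ+, Separates x (ε / 2) η F ∅ ∧ ε / 2 / K ≤ ∑ k ∈ F, μ k := by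
  classical
  obtain ⟨g, hg, hgv⟩ := exists_dual_vector'' ℝ (act μ x)
  set F := μ.support.filter fun k => ε / 2 ≤ g (x k) with hF
  refine ⟨F, ⟨g, hg, fun n hn => (Finset.mem_filter.1 hn).2, by simp⟩, ?_⟩
  have h1 : ε < ∑ k ∈ μ.support, μ k * g (x k) := by
    have h0 : g (act μ x) = ∑ k ∈ μ.support, μ k * g (x k) := by simp [act_eq_sum]
    rw [← h0, hgv]
    exact h
  have h2 : ∑ k ∈ μ.support, μ k * g (x k) ≤
      ∑ k ∈ μ.support, ((if k ∈ F then μ k * K else 0) + μ k * (ε / 2)) := by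
    refine Finset.sum_le_sum fun k hk => ?_
    have hμk := hμ k
    split_ifs with hkF
    · have h3 : g (x k) ≤ K := ((le_abs_self _).trans (g.le_opNorm (x k))).trans <| by
        calc ‖g‖ * ‖x k‖ ≤ 1 * ‖x k‖ := by gcongr
          _ ≤ K := by simpa using hxK k
      have := mul_le_mul_of_nonneg_left h3 hμk
      have := mul_nonneg hμk (half_pos hε).le
      linarith
    · rw [hF, Finset.mem_filter, not_and] at hkF
      have := mul_le_mul_of_nonneg_left (not_le.1 (hkF hk)).le hμk
      linarith
  rw [Finset.sum_add_distrib, Finset.sum_ite_mem,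
    Finset.inter_eq_right.2 (hF ▸ Finset.filter_subset _ _), ← Finset.sum_mul, ← Finset.sum_mul,
    hsum] at h2
  rw [div_le_iff₀ hK]
  linarith

/-- A functional which is at least `δ` where the coefficients are nonnegative and at most `δ / 2`
in absolute value where they are negative gives a lower `ℓ₁`-estimate. -/
lemma le_norm_sum {ι : Type*} {y : ι → X} {δ : ℝ} (hδ : 0 < δ) {F : Finset ι} {a : ι → ℝ}
    (ha : 0 ≤ ∑ i ∈ F, a i) {g : X →L[ℝ] ℝ} (hg : ‖g‖ ≤ 1)
    (hpos : ∀ i ∈ F, 0 ≤ a i → δ ≤ g (y i)) (hneg : ∀ i ∈ F, a i < 0 → |g (y i)| ≤ δ / 2) :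
    δ / 4 * ∑ i ∈ F, |a i| ≤ ‖∑ i ∈ F, a i • y i‖ := by
  have h1 : ∀ i ∈ F, δ / 4 * |a i| + 3 / 4 * δ * a i ≤ a i * g (y i) := by
    intro i hi
    rcases le_or_gt 0 (a i) with h | h
    · rw [abs_of_nonneg h]
      have := mul_le_mul_of_nonneg_left (hpos i hi h) h
      linarith
    · rw [abs_of_neg h]
      have := mul_le_mul_of_nonpos_left ((le_abs_self _).trans (hneg i hi h)) h.le
      linarith
  have h2 := Finset.sum_le_sum h1
  rw [Finset.sum_add_distrib, ← Finset.mul_sum, ← Finset.mul_sum] at h2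
  have h3 : ∑ i ∈ F, a i * g (y i) ≤ ‖∑ i ∈ F, a i • y i‖ := by
    have h4 : g (∑ i ∈ F, a i • y i) = ∑ i ∈ F, a i * g (y i) := by simp
    rw [← h4]
    calc g (∑ i ∈ F, a i • y i) ≤ ‖g‖ * ‖∑ i ∈ F, a i • y i‖ :=
          (le_abs_self _).trans (g.le_opNorm _)
      _ ≤ 1 * ‖∑ i ∈ F, a i • y i‖ := by gcongr
      _ = _ := one_mul _
  have h5 : 0 ≤ 3 / 4 * δ * ∑ i ∈ F, a i := by positivity
  linarith

/-- Averages with norms bounded away from zero produce an `ℓ₁^ξ` spreading model. -/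
theorem exists_spreadingModel {x : ℕ+ → X} (hx : WeaklyNull x) {ξ : Ordinal.{0}} (hξ : ξ < ω₁)
    {ε : ℝ} (hε : 0 < ε) {M : Set ℕ+} (hM : M.Infinite)
    (h : ∀ L ⊆ M, L.Infinite → ε < ‖act (firstAverage A ξ L) x‖) :
    ∃ m : ℕ+ → ℕ+, StrictMono m ∧ IsL1SpreadingModel A ξ fun i => x (m i) := by
  classical
  have hf := isInitialAverage_firstAverage A ξ hξ
  obtain ⟨K, hK, hxK⟩ := hx.exists_norm_le
  set δ := ε / 2 with hδdef
  have hδ : 0 < δ := half_pos hε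
  obtain ⟨N₁, hN₁M, hN₁, hunc⟩ := hx.exists_unconditional δ (half_pos hδ) hM
  obtain ⟨N, hN, hNi, hcap⟩ := largeCaptures A ξ hξ {F | Separates x δ (δ / 2) F ∅}
    (fun F G hGF hF => hF.mono hGF subset_rfl) (δ / K) (div_pos hδ hK) N₁ hN₁
    fun L hL hLi => by
      obtain ⟨F, hF, hFμ⟩ := exists_separates_of_lt_norm_act (η := δ / 2) hK hxK hε (hf.nonneg hLi)
        (hf.sum_eq hLi _ subset_rfl) (h L (hL.trans hN₁M) hLi)
      refine ⟨F, hF, fun i hi => ?_⟩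
      obtain rfl : i = 0 := by omega
      exact hFμ
  obtain ⟨m, hm, hmN⟩ := exists_strictMono_mem hNi
  have lower : ∀ F ∈ schreier A ξ, ∀ a : ℕ+ → ℝ, 0 ≤ ∑ i ∈ F, a i →
      δ / 4 * ∑ i ∈ F, |a i| ≤ ‖∑ i ∈ F, a i • x (m i)‖ := by
    intro F hF a ha
    have hsub : (F.filter fun i => 0 ≤ a i).image m ⊆ F.image m :=
      Finset.image_subset_image (Finset.filter_subset _ _)
    have hsep : Separates x δ (δ / 2) (F.image m) ∅ := hcap m hm hmN F hF
    obtain ⟨g, hg, hg1, hg2⟩ := hunc (F.image m) (fun q hq => by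
      obtain ⟨i, _, rfl⟩ := Finset.mem_image.1 hq
      exact hN (hmN i)) _ hsub (hsep.mono hsub subset_rfl)
    refine le_norm_sum hδ ha hg (fun i hi hai => ?_) fun i hi hai => ?_
    · exact hg1 _ (Finset.mem_image_of_mem m (Finset.mem_filter.2 ⟨hi, hai⟩))
    · refine hg2 _ (Finset.mem_sdiff.2 ⟨Finset.mem_image_of_mem m hi, fun hmem => ?_⟩)
      obtain ⟨j, hj, hji⟩ := Finset.mem_image.1 hmem
      rw [hm.injective hji] at hj
      exact absurd (Finset.mem_filter.1 hj).2 (not_le.2 hai)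
  have lower' : ∀ F ∈ schreier A ξ, ∀ a : ℕ+ → ℝ,
      δ / 4 * ∑ i ∈ F, |a i| ≤ ‖∑ i ∈ F, a i • x (m i)‖ := by
    intro F hF a
    rcases le_total 0 (∑ i ∈ F, a i) with ha | ha
    · exact lower F hF a ha
    · have := lower F hF (fun i => -a i) (by simpa using ha)
      simpa using this
  refine ⟨m, hm, ⟨δ / 4, K, by positivity, fun i => ⟨?_, hxK _⟩⟩, δ / 4, by positivity, lower'⟩
  simpa using lower' {i} (singleton_mem_schreier A i ξ hξ) fun _ => 1

end RepeatedAverages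

theorem theoremT {X : Type*} [NormedAddCommGroup X] [NormedSpace ℝ X] [CompleteSpace X]
    (A : RepeatedAverages.AssociatedSequences)
    (x : ℕ+ → X) (hx : RepeatedAverages.WeaklyNull x)
    (ξ : Ordinal.{0}) (hξ : 1 ≤ ξ) (hξ' : ξ < ω₁) :
    Xor
      (∀ M : Set ℕ+, M.Infinite → ∃ N : Set ℕ+, N ⊆ M ∧ N.Infinite ∧
        ∀ L : Set ℕ+, L ⊆ N → L.Infinite → RepeatedAverages.IsConvergentAlong A ξ L x)
      (∃ m : ℕ+ → ℕ+, StrictMono m ∧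
        RepeatedAverages.IsL1SpreadingModel A ξ (fun i => x (m i))) := by
  have hexcl : (∃ m : ℕ+ → ℕ+, StrictMono m ∧
      RepeatedAverages.IsL1SpreadingModel A ξ (fun i => x (m i))) →
      ¬ ∀ M : Set ℕ+, M.Infinite → ∃ N : Set ℕ+, N ⊆ M ∧ N.Infinite ∧
        ∀ L : Set ℕ+, L ⊆ N → L.Infinite → RepeatedAverages.IsConvergentAlong A ξ L x := by
    rintro ⟨m, hm, hsp⟩ hconv
    obtain ⟨N, hNm, hN, hL⟩ := hconv _ (Set.infinite_range_of_injective hm.injective)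
    obtain ⟨L, hLN, hLi, hnot⟩ :=
      RepeatedAverages.not_convergent_of_spreadingModel A hξ hξ' hm hsp hN hNm
    exact hnot (hL L hLN hLi)
  by_cases hconv : ∀ M : Set ℕ+, M.Infinite → ∃ N : Set ℕ+, N ⊆ M ∧ N.Infinite ∧
      ∀ L : Set ℕ+, L ⊆ N → L.Infinite → RepeatedAverages.IsConvergentAlong A ξ L x
  · exact Or.inl ⟨hconv, fun h => hexcl h hconv⟩
  · refine Or.inr ⟨?_, hconv⟩
    push Not at hconv
    obtain ⟨M, hM, hno⟩ := hconv
    obtain ⟨ε, hε, N, _, hN, hlow⟩ := RepeatedAverages.exists_norm_act_gt A hξ' hM hno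
    exact RepeatedAverages.exists_spreadingModel A hx hξ' hε hN hlow
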